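/- Let $V$ be a vertex operator algebra over $\mathbb C$ ($\mathbb Z$-graded by $L(0)$-eigenvalues, with finite-dimensional weight spaces $V_n$ that vanish for $n\ll 0$). A $V$-module $W$ is *$\mathbb N$-gradable* if $W=\bigoplus_{m\in\mathbb N}W_{(m)}$ with $\alpha_kW_{(m)}\subseteq W_{(m+\mathrm{wt}(\alpha)-k-1)}$ for all homogeneous $\alpha\in V$ and $k\in\mathbb Z$ (where $W_{(i)}=0$ for $i<0$), and *$C_1$-cofinite* if $\dim W/C_1(W)<\infty$, where $C_1(W)$ is the span of all $\alpha_{-1}w$ with $w\in W$ and $\alpha\in V$ homogeneous, $\mathrm{wt}(\alpha)\ge 1$. Write $W^\vee=\bigoplus_m\mathrm{Hom}(W_{(m)},\mathbb C)$. A *fusion product* of $V$-modules $M,N$ is an $\mathbb N$-gradable module $M\boxtimes N$ with a logarithmic intertwining operator $\mathcal Y$ of type $\binom{M\boxtimes N}{M\;N}$ such that for every $\mathbb N$-gradable module $D$ and every logarithmic intertwining operator $\mathcal Y'$ of type $\binom{D}{M\;N}$ there is a unique $V$-homomorphism $\phi:M\boxtimes N\to D$ with $\phi(\mathcal Y(v,z)u)=\mathcal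 Y'(v,z)u$ for all $v\in M$, $u\in N$. A logarithmic intertwining operator has the form $\mathcal Y(v,z)=\sum_{k=0}^{K}\mathcal Y_k(v,z)\log^k z$, where each $\mathcal Y_k(v,z)$ is a formal series in complex powers of $z$, without logarithms. Let $A,B,C$ be $C_1$-cofinite $\mathbb N$-gradable $V$-modules, and let $(A\boxtimes B,\mathcal Y^{AB})$, $(B\boxtimes C,\mathcal Y^{BC})$, $(A\boxtimes(B\boxtimes C),\mathcal Y^{A(BC)})$ and $((A\boxtimes B)\boxtimes C,\mathcal Y^{(AB)C})$ be fusion products. For $v\in A$, $u\in B$, $w\in C$, $\theta\in(A\boxtimes(B\boxtimes C))^\vee$, $\theta'\in((A\boxtimes B)\boxtimes C)^\vee$ and $h,k\in\mathbb N$ consider the formal series in complex powers $$F^{A(BC)}_{h,k}(\theta,v,u,w;x,y)=\langle\theta,\mathcal Y^{A(BC)}_h(v,x)\,\mathcal Y^{BC}_k(u,y)w\rangle=\sum_{a,b\in\mathbb C}c_{a,b}\,x^ay^b,$$ $$F^{(AB)C}_{h,k}(\theta',v,u,w;x-y,y)=\langle\theta',\mathcal Y^{(AB)C}_h(\mathcal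 Y^{AB}_k(v,x-y)u,y)w\rangle=\sum_{a,b\in\mathbb C}c'_{a,b}\,(x-y)^ay^b.$$ **Corollary 3.3.** For all such $\theta,\theta',v,u,w,h,k$, the series $F^{A(BC)}_{h,k}(\theta,v,u,w;x,y)$ is locally normally convergent on $\{(x,y)\in\mathbb C^2\mid 0<|y|<|x|\}$, and the series $F^{(AB)C}_{h,k}(\theta',v,u,w;x-y,y)$ is locally normally convergent on $\{(x,y)\in\mathbb C^2\mid 0<|x-y|<|y|\}$. Here a series $\sum_{a,b}c_{a,b}X^aY^b$ in functions $X,Y$ is *locally normally convergent* on a set $D$ if for every compact $K\subseteq D$ and all continuous branches of $\log X$ and $\log Y$ on $K$, which define $X^aY^b=e^{a\log X+b\log Y}$, one has $\sum_{a,b}\sup_K|c_{a,b}X^aY^b|<\infty$. -/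

import Mathlib

universe u

/-- A vertex operator algebra over `ℂ`, given by its modes: `Y(a, z) = ∑ n, (mode a n) z ^ (-n - 1)`,
so that `mode a n b` is `a_n b`. The conformal weight spaces are the eigenspaces of
`L(0) = conf_1`; they are finite-dimensional and vanish in sufficiently negative weights. -/
class VertexOperatorAlgebra (V : Type u) [AddCommGroup V] [Module ℂ V] where
  mode : V →ₗ[ℂ] (ℤ → (V →ₗ[ℂ] V))
  /-- the vacuum vector `𝟙` -/
  vac : V
  /-- the conformal vector `ω`, with `L(n) = ω_{n+1}` -/
  conf : V
  centralCharge : ℂ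
  truncation : ∀ a b : V, ∃ N : ℤ, ∀ n : ℤ, N ≤ n → mode a n b = 0
  vac_mode : ∀ (n : ℤ) (b : V), mode vac n b = if n = -1 then b else 0
  mode_vac : ∀ (a : V) (n : ℤ), 0 ≤ n → mode a n vac = 0
  creation : ∀ a : V, mode a (-1) vac = a
  /-- The Borcherds (Jacobi) identity; all the sums are finite by truncation. -/
  borcherds : ∀ (a b c : V) (m n p : ℤ),
    ∑ᶠ j : ℕ, ((Ring.choose m j : ℤ) : ℂ) • mode (mode a (n + j) b) (p + m - j) c =
      ∑ᶠ j : ℕ, ((-1 : ℂ) ^ j * ((Ring.choose n j : ℤ) : ℂ)) •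
          mode a (m + n - j) (mode b (p + j) c) -
      ∑ᶠ j : ℕ, ((-1 : ℂ) ^ n * (-1 : ℂ) ^ j * ((Ring.choose n j : ℤ) : ℂ)) •
          mode b (p + n - j) (mode a (m + j) c)
  virasoro : ∀ (m n : ℤ) (b : V),
    mode conf (m + 1) (mode conf (n + 1) b) - mode conf (n + 1) (mode conf (m + 1) b) =
      ((m : ℂ) - n) • mode conf (m + n + 1) b +
        (if m + n = 0 then (((m : ℂ) ^ 3 - m) / 12 * centralCharge) • b else 0)
  /-- `Y(L(-1) a, z) = d/dz Y(a, z)` -/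
  derivative : ∀ (a b : V) (n : ℤ),
    mode (mode conf 0 a) n b = (-(n : ℂ)) • mode a (n - 1) b
  isInternal_weight :
    DirectSum.IsInternal fun n : ℤ => Module.End.eigenspace (mode conf 1) (n : ℂ)
  finite_weight : ∀ n : ℤ,
    FiniteDimensional ℂ (Module.End.eigenspace (mode conf 1) (n : ℂ))
  weight_bddBelow : ∃ N : ℤ, ∀ n : ℤ, n < N →
    Module.End.eigenspace (mode conf 1) (n : ℂ) = ⊥

/-- The space `V_n` of elements of conformal weight `n`. -/
def weightSpace (V : Type u) [AddCommGroup V] [Module ℂ V] [VertexOperatorAlgebra V] (n : ℤ) :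
    Submodule ℂ V :=
  Module.End.eigenspace (VertexOperatorAlgebra.mode (VertexOperatorAlgebra.conf (V := V)) 1) (n : ℂ)

/-- A (weak) module `W` over a vertex operator algebra `V`; `act a n w` is `a_n w`, where
`Y^W(a, z) = ∑ n, a_n z ^ (-n - 1)`. No grading is part of the structure. -/
class VOAModule (V : Type u) [AddCommGroup V] [Module ℂ V] [VertexOperatorAlgebra V]
    (W : Type u) [AddCommGroup W] [Module ℂ W] where
  act : V →ₗ[ℂ] (ℤ → (W →ₗ[ℂ] W))
  truncation : ∀ (a : V) (w : W), ∃ N : ℤ, ∀ n : ℤ, N ≤ n → act a n w = 0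
  vac_act : ∀ (n : ℤ) (w : W),
    act VertexOperatorAlgebra.vac n w = if n = -1 then w else 0
  borcherds : ∀ (a b : V) (w : W) (m n p : ℤ),
    ∑ᶠ j : ℕ, ((Ring.choose m j : ℤ) : ℂ) •
        act (VertexOperatorAlgebra.mode a (n + j) b) (p + m - j) w =
      ∑ᶠ j : ℕ, ((-1 : ℂ) ^ j * ((Ring.choose n j : ℤ) : ℂ)) •
          act a (m + n - j) (act b (p + j) w) -
      ∑ᶠ j : ℕ, ((-1 : ℂ) ^ n * (-1 : ℂ) ^ j * ((Ring.choose n j : ℤ) : ℂ)) •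
          act b (p + n - j) (act a (m + j) w)

section Modules

variable (V : Type u) [AddCommGroup V] [Module ℂ V] [VertexOperatorAlgebra V]

/-- An `ℕ`-grading `W = ⨁ m, W_(m)` with `a_k W_(m) ⊆ W_(m + wt(a) - k - 1)` for homogeneous
`a` in `V` and all `k`, where `W_(i) = 0` for `i < 0`. -/
structure NGrading (W : Type u) [AddCommGroup W] [Module ℂ W] [VOAModule V W] where
  piece : ℕ → Submodule ℂ W
  isInternal : DirectSum.IsInternal piece
  act_mem : ∀ (d : ℤ) (a : V), a ∈ weightSpace V d → ∀ (k : ℤ) (m : ℕ) (w : W), w ∈ piece m →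
    (∀ i : ℕ, (i : ℤ) = m + d - k - 1 → VOAModule.act a k w ∈ piece i) ∧
    ((m : ℤ) + d - k - 1 < 0 → VOAModule.act a k w = 0)

/-- The restricted dual `W^∨ = ⨁ m, Hom(W_(m), ℂ)`, as the space of the linear functionals on `W`
that vanish on all but finitely many of the `W_(m)`. -/
def NGrading.restrictedDual {V : Type u} [AddCommGroup V] [Module ℂ V] [VertexOperatorAlgebra V]
    {W : Type u} [AddCommGroup W] [Module ℂ W] [VOAModule V W] (g : NGrading V W) :
    Set (Module.Dual ℂ W) :=
  {θ | ∃ N : ℕ, ∀ m : ℕ, N < m → ∀ w ∈ g.piece m, θ w = 0}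

/-- `W` is `ℕ`-gradable. -/
def IsNGradable (W : Type u) [AddCommGroup W] [Module ℂ W] [VOAModule V W] : Prop :=
  Nonempty (NGrading V W)

/-- `C_1(W)`, the span of all `a_{-1} w` with `w` in `W` and `a` in `V` of weight at least `1`. -/
def C1Subspace (W : Type u) [AddCommGroup W] [Module ℂ W] [VOAModule V W] : Submodule ℂ W :=
  Submodule.span ℂ
    {x : W | ∃ d : ℤ, 1 ≤ d ∧ ∃ a ∈ weightSpace V d, ∃ w : W, x = VOAModule.act a (-1) w}

/-- `W` is a `C_1`-cofinite `ℕ`-gradable `V`-module. -/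
structure IsC1CofiniteNGradable (W : Type u) [AddCommGroup W] [Module ℂ W] [VOAModule V W] :
    Prop where
  ngradable : IsNGradable V W
  cofinite : FiniteDimensional ℂ (W ⧸ C1Subspace V W)

/-- `f` is a homomorphism of `V`-modules. -/
def IsVOAModuleHom {W D : Type u} [AddCommGroup W] [Module ℂ W] [VOAModule V W]
    [AddCommGroup D] [Module ℂ D] [VOAModule V D] (f : W →ₗ[ℂ] D) : Prop :=
  ∀ (a : V) (n : ℤ) (w : W), f (VOAModule.act a n w) = VOAModule.act a n (f w)

/-- A logarithmic intertwining operator of type `(D over A, B)`: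
`Y(v, z) u = ∑_{k ≤ K} ∑_{s ∈ ℂ} (coeff k s v u) z ^ (-s - 1) log(z) ^ k`. -/
structure LogIntertwiningOperator (A B D : Type u)
    [AddCommGroup A] [Module ℂ A] [VOAModule V A] [AddCommGroup B] [Module ℂ B] [VOAModule V B]
    [AddCommGroup D] [Module ℂ D] [VOAModule V D] where
  coeff : ℕ → ℂ → (A →ₗ[ℂ] B →ₗ[ℂ] D)
  log_bound : ∃ K : ℕ, ∀ k : ℕ, K < k → ∀ s : ℂ, coeff k s = 0
  truncation : ∀ (v : A) (u : B) (s : ℂ), ∃ N : ℕ, ∀ m : ℕ, N ≤ m → ∀ k : ℕ,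
    coeff k (s + m) v u = 0
  /-- The Borcherds (Jacobi) identity, for each power of the logarithm. -/
  borcherds : ∀ (a : V) (v : A) (u : B) (m n : ℤ) (s : ℂ) (k : ℕ),
    ∑ᶠ j : ℕ, ((Ring.choose m j : ℤ) : ℂ) • coeff k (s + m - j) (VOAModule.act a (n + j) v) u =
      ∑ᶠ j : ℕ, ((-1 : ℂ) ^ j * ((Ring.choose n j : ℤ) : ℂ)) •
          VOAModule.act a (m + n - j) (coeff k (s + j) v u) -
      ∑ᶠ j : ℕ, ((-1 : ℂ) ^ n * (-1 : ℂ) ^ j * ((Ring.choose n j : ℤ) : ℂ)) •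
          coeff k (s + n - j) v (VOAModule.act a (m + j) u)
  /-- `Y(L(-1) v, z) = d/dz Y(v, z)`, compared at `z ^ (-s - 1) log(z) ^ k`. -/
  derivative : ∀ (v : A) (u : B) (s : ℂ) (k : ℕ),
    coeff k s (VOAModule.act (VertexOperatorAlgebra.conf (V := V)) 0 v) u =
      (-s) • coeff k (s - 1) v u + ((k : ℂ) + 1) • coeff (k + 1) (s - 1) v u

/-- `(P, Y)` is a fusion product of `A` and `B`: `P` is `ℕ`-gradable, and every logarithmic
intertwining operator from `A`, `B` to an `ℕ`-gradable module `D` is the composition of `Y` with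
a unique homomorphism `P → D`. -/
def IsFusionProduct {A B P : Type u}
    [AddCommGroup A] [Module ℂ A] [VOAModule V A] [AddCommGroup B] [Module ℂ B] [VOAModule V B]
    [AddCommGroup P] [Module ℂ P] [VOAModule V P] (Y : LogIntertwiningOperator V A B P) : Prop :=
  IsNGradable V P ∧
    ∀ (D : Type u) [AddCommGroup D] [Module ℂ D] [VOAModule V D], IsNGradable V D →
      ∀ Y' : LogIntertwiningOperator V A B D,
        ∃! φ : P →ₗ[ℂ] D, IsVOAModuleHom V φ ∧
          ∀ (k : ℕ) (s : ℂ) (v : A) (u : B), φ (Y.coeff k s v u) = Y'.coeff k s v u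

end Modules

section Series

variable {V : Type u} [AddCommGroup V] [Module ℂ V] [VertexOperatorAlgebra V]
  {A B C P Q : Type u}
  [AddCommGroup A] [Module ℂ A] [VOAModule V A] [AddCommGroup B] [Module ℂ B] [VOAModule V B]
  [AddCommGroup C] [Module ℂ C] [VOAModule V C] [AddCommGroup P] [Module ℂ P] [VOAModule V P]
  [AddCommGroup Q] [Module ℂ Q] [VOAModule V Q]

/-- The formal series `⟨θ, Y¹_h(v, x) Y²_k(u, y) w⟩`, the coefficient of `log(x)^h log(y)^k` in
`⟨θ, Y¹(v, x) Y²(u, y) w⟩`: the value at `(a, b)` is the coefficient of `x ^ a * y ^ b`. -/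
def productSeries (Y₁ : LogIntertwiningOperator V A P Q) (Y₂ : LogIntertwiningOperator V B C P)
    (θ : Module.Dual ℂ Q) (v : A) (u : B) (w : C) (h k : ℕ) : ℂ × ℂ → ℂ :=
  fun e => θ (Y₁.coeff h (-e.1 - 1) v (Y₂.coeff k (-e.2 - 1) u w))

/-- The formal series `⟨θ, Y¹_h(Y²_k(v, x - y) u, y) w⟩`, the coefficient of
`log(y)^h log(x - y)^k` in `⟨θ, Y¹(Y²(v, x - y) u, y) w⟩`: the value at `(a, b)` is the
coefficient of `(x - y) ^ a * y ^ b`. -/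
def iterateSeries (Y₁ : LogIntertwiningOperator V P C Q) (Y₂ : LogIntertwiningOperator V A B P)
    (θ : Module.Dual ℂ Q) (v : A) (u : B) (w : C) (h k : ℕ) : ℂ × ℂ → ℂ :=
  fun e => θ (Y₁.coeff h (-e.2 - 1) (Y₂.coeff k (-e.1 - 1) v u) w)

end Series

/-- Local normal convergence on `D` of the series `∑_{(a, b) ∈ ℂ × ℂ} c (a, b) X ^ a Y ^ b`, whose
terms are multivalued functions: on every compact `K ⊆ D`, and for all continuous branches
`lX`, `lY` of `log X` and `log Y` on `K`, the series with `X ^ a Y ^ b = exp (a lX + b lY)` is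
dominated on `K`, term by term, by a convergent series of constants. -/
def LocallyNormallyConvergentOn (c : ℂ × ℂ → ℂ) (X Y : ℂ × ℂ → ℂ) (D : Set (ℂ × ℂ)) : Prop :=
  ∀ K : Set (ℂ × ℂ), K ⊆ D → IsCompact K →
    ∀ lX lY : ℂ × ℂ → ℂ, ContinuousOn lX K → ContinuousOn lY K →
      (∀ p ∈ K, Complex.exp (lX p) = X p) → (∀ p ∈ K, Complex.exp (lY p) = Y p) →
        ∃ M : ℂ × ℂ → ℝ, Summable M ∧
          ∀ e : ℂ × ℂ, ∀ p ∈ K, ‖c e * Complex.exp (e.1 * lX p + e.2 * lY p)‖ ≤ M e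

/-! Both kinds of series solve differential systems with a regular singularity at t = 0, where t =
Y/X is y/x for products and (x - y)/y for iterates; the coefficients of the systems are power series
in t converging for |t| < 1.

For homogeneous arguments, normalize the series by the monomial in X and Y that the degrees m, p, q,
r of the functional and of the three vectors determine. The Borcherds identity then moves a mode
a_{-1}, with a of weight d ≥ 1, off any of the vectors, at the cost of coefficients that are power
series in t with polynomially bounded coefficients. In the resulting terms either the total degree p
+ q + r is lower than before, or the functional is composed with a mode that raises degrees, so that
its own degree m drops. By C_1-cofiniteness every vector of high degree is a sum of elements
a_{-1}w, and all graded pieces are finite-dimensional (`exists_piece_le_c1Piece`, `fg_piece`). The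
Euler operators are expressed through L(-1), which changes one degree by one, and the reductions
undo that change. Induction on m yields a finite-dimensional space S of series which both Euler
operators map into the combinations of S with power series in t
(`IsReducibleFamily.exists_differential_system`). All powers of the logarithms are treated together,
since differentiation couples the index h to h + 1.

For such an S, comparison of leading coefficients confines the leading exponents to eigenvalues of
two matrices, so the support lies on finitely many strings (a - n, b + n). The recursion along a
string bounds the coefficients by a multiple of ρ^(-n) for every ρ < 1
(`isStringConvergent_of_differential_system`), which gives normal convergence where |Y| < |X|. The
notion `IsReducibleFamily` serves products and iterates alike; only the reductions differ. -/

/-- Formal series `∑ c (a, b) X ^ a Y ^ b` in complex powers, given by their coefficients. -/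
abbrev ComplexPowerSeries := ℂ × ℂ → ℂ

/-! ### Power series in Y/X with polynomially bounded coefficients, acting on formal series. -/

/-- The polynomially bounded sequences of coefficients. -/
def polyBounded : Submodule ℂ (ℕ → ℂ) where
  carrier := {q | ∃ (C : ℝ) (k : ℕ), 0 ≤ C ∧ ∀ n, ‖q n‖ ≤ C * ((n : ℝ) + 1) ^ k}
  add_mem' := by
    rintro q q' ⟨C, k, hC, h⟩ ⟨C', k', hC', h'⟩
    refine ⟨C + C', max k k', by positivity, fun n => ?_⟩
    have h1 : (1 : ℝ) ≤ (n : ℝ) + 1 := by linarith [n.cast_nonneg (α := ℝ)]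
    calc ‖q n + q' n‖ ≤ ‖q n‖ + ‖q' n‖ := norm_add_le _ _
      _ ≤ C * ((n : ℝ) + 1) ^ k + C' * ((n : ℝ) + 1) ^ k' := add_le_add (h n) (h' n)
      _ ≤ C * ((n : ℝ) + 1) ^ max k k' + C' * ((n : ℝ) + 1) ^ max k k' := by
          gcongr
          · exact le_max_left _ _
          · exact le_max_right _ _
      _ = _ := by ring
  zero_mem' := ⟨0, 0, le_rfl, fun n => by simp⟩
  smul_mem' := by
    rintro c q ⟨C, k, hC, h⟩
    refine ⟨‖c‖ * C, k, by positivity, fun n => ?_⟩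
    simp only [Pi.smul_apply, smul_eq_mul, norm_mul, mul_assoc]
    exact mul_le_mul_of_nonneg_left (h n) (norm_nonneg _)

lemma summable_norm_mul_pow_of_mem_polyBounded {q : ℕ → ℂ} (hq : q ∈ polyBounded) {ρ : ℝ}
    (h0 : 0 < ρ) (h1 : ρ < 1) : Summable fun n => ‖q n‖ * ρ ^ n := by
  obtain ⟨C, k, hC, h⟩ := hq
  have hs : Summable fun n : ℕ => ((n : ℝ)) ^ k * ρ ^ n :=
    summable_pow_mul_geometric_of_norm_lt_one k (by rw [Real.norm_of_nonneg h0.le]; exact h1)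
  have hs' := (((summable_nat_add_iff 1).2 hs).mul_left (C * ρ⁻¹))
  refine Summable.of_nonneg_of_le (fun n => by positivity) (fun n => ?_) hs'
  calc ‖q n‖ * ρ ^ n ≤ C * ((n : ℝ) + 1) ^ k * ρ ^ n := by gcongr; exact h n
    _ = _ := by push_cast; field_simp; ring

lemma mem_polyBounded_of_norm_le_pow {q : ℕ → ℂ} (C k : ℕ)
    (h : ∀ n, ‖q n‖ ≤ ((n : ℝ) + C) ^ k) : q ∈ polyBounded := by
  refine ⟨((C : ℝ) + 1) ^ k, k, by positivity, fun n => (h n).trans ?_⟩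
  rw [← mul_pow]
  gcongr
  nlinarith [n.cast_nonneg (α := ℝ), C.cast_nonneg (α := ℝ),
    mul_nonneg (n.cast_nonneg (α := ℝ)) (C.cast_nonneg (α := ℝ))]

/-- The binomial is a polynomial of degree i in j. It arises when the modes a_{d+j}, j ≥ 0, are
commuted past an intertwining operator. -/
lemma choose_mem_polyBounded (d i : ℕ) :
    (fun j : ℕ => ((Ring.choose ((d : ℤ) + j) i : ℤ) : ℂ)) ∈ polyBounded := by
  refine mem_polyBounded_of_norm_le_pow d i fun n => ?_
  rw [← Nat.cast_add, Ring.choose_natCast]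
  simp only [Int.cast_natCast, Complex.norm_natCast]
  calc (((d + n).choose i : ℕ) : ℝ) ≤ (((d + n) ^ i : ℕ) : ℝ) :=
        Nat.cast_le.2 (Nat.choose_le_pow _ _)
    _ = _ := by push_cast; ring

lemma norm_choose_neg (j i : ℕ) :
    ‖((Ring.choose (-1 - (j : ℤ)) i : ℤ) : ℂ)‖ = (((i + j).choose i : ℕ) : ℝ) := by
  have h : (-1 - (j : ℤ)) = -((j + 1 : ℕ) : ℤ) := by push_cast; ring
  have h2 : (((j + 1 : ℕ) : ℤ) + (i : ℤ) - 1) = ((i + j : ℕ) : ℤ) := by push_cast; ring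
  rw [h, Ring.choose_neg, h2, Ring.choose_natCast, Units.smul_def]
  simp [Int.negOnePow]

/-- Up to sign this is the binomial of i + j over i, again polynomial in j. It arises from the modes
a_{-1-j}. -/
lemma choose_neg_mem_polyBounded (i : ℕ) :
    (fun j : ℕ => ((Ring.choose (-1 - (j : ℤ)) i : ℤ) : ℂ)) ∈ polyBounded := by
  refine mem_polyBounded_of_norm_le_pow i i fun n => ?_
  rw [norm_choose_neg]
  calc (((i + n).choose i : ℕ) : ℝ) ≤ (((i + n) ^ i : ℕ) : ℝ) :=
        Nat.cast_le.2 (Nat.choose_le_pow _ _)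
    _ = _ := by push_cast; ring

lemma mem_polyBounded_of_finite {q : ℕ → ℂ} {N : ℕ} (hq : ∀ n, N ≤ n → q n = 0) :
    q ∈ polyBounded := by
  refine ⟨∑ n ∈ Finset.range N, ‖q n‖, 0, by positivity, fun n => ?_⟩
  rcases lt_or_ge n N with h | h
  · simpa using Finset.single_le_sum (f := fun n => ‖q n‖) (fun _ _ => norm_nonneg _)
      (Finset.mem_range.2 h)
  · rw [hq n h]; simp; positivity

lemma finsum_eq_sum_range {E : Type*} [AddCommMonoid E] {f : ℕ → E} {N : ℕ}
    (h : ∀ n, N ≤ n → f n = 0) : ∑ᶠ n, f n = ∑ n ∈ Finset.range N, f n :=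
  finsum_eq_sum_of_support_subset f fun n hn => by
    by_contra h'
    exact hn (h n (by simpa using h'))

/-- The series on which power series in `Y / X` act. -/
def truncatedSeries : Submodule ℂ ComplexPowerSeries where
  carrier := {g | ∀ e : ℂ × ℂ, ∃ N : ℕ, ∀ n : ℕ, N ≤ n → g (e.1 + n, e.2 - n) = 0}
  add_mem' := by
    intro f g hf hg e
    obtain ⟨N, hN⟩ := hf e
    obtain ⟨N', hN'⟩ := hg e
    exact ⟨max N N', fun n hn => by
      simp [hN n (le_of_max_le_left hn), hN' n (le_of_max_le_right hn)]⟩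
  zero_mem' := fun _ => ⟨0, fun _ _ => rfl⟩
  smul_mem' := by
    intro c f hf e
    obtain ⟨N, hN⟩ := hf e
    exact ⟨N, fun n hn => by simp [hN n hn]⟩

/-- The product of `g` with `∑ n, q n (Y / X) ^ (P + n)`. -/
noncomputable def powerSeriesMul (P : ℕ) (q : ℕ → ℂ) (g : ComplexPowerSeries) :
    ComplexPowerSeries :=
  fun e => ∑ᶠ n : ℕ, q n * g (e.1 + ((P + n : ℕ) : ℂ), e.2 - ((P + n : ℕ) : ℂ))

/-- The combinations of members of `S` with polynomially bounded power series in `Y / X`. -/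
def powerSeriesSpan (S : Set ComplexPowerSeries) : Submodule ℂ ComplexPowerSeries :=
  Submodule.span ℂ {f | ∃ (P : ℕ), ∃ q ∈ polyBounded, ∃ g ∈ S, f = powerSeriesMul P q g}

lemma powerSeriesSpan_mono {S T : Set ComplexPowerSeries} (h : S ⊆ T) :
    powerSeriesSpan S ≤ powerSeriesSpan T :=
  Submodule.span_mono fun _ ⟨P, q, hq, g, hg, hf⟩ => ⟨P, q, hq, g, h hg, hf⟩

lemma powerSeriesMul_mem_span {S : Set ComplexPowerSeries} (P : ℕ) {q : ℕ → ℂ}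
    (hq : q ∈ polyBounded) {g : ComplexPowerSeries} (hg : g ∈ S) :
    powerSeriesMul P q g ∈ powerSeriesSpan S :=
  Submodule.subset_span ⟨P, q, hq, g, hg, rfl⟩

lemma powerSeriesMul_single (P : ℕ) (g : ComplexPowerSeries) (e : ℂ × ℂ) :
    powerSeriesMul P (fun n => if n = 0 then 1 else 0) g e = g (e.1 + P, e.2 - P) := by
  rw [powerSeriesMul, finsum_eq_single _ 0 (fun n hn => by simp [hn])]
  simp

lemma shift_mem_powerSeriesSpan {S : Set ComplexPowerSeries} (P : ℕ) {g : ComplexPowerSeries}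
    (hg : g ∈ S) : (fun e => g (e.1 + P, e.2 - P)) ∈ powerSeriesSpan S := by
  have := powerSeriesMul_mem_span P (q := fun n => if n = 0 then 1 else 0)
    (mem_polyBounded_of_finite (N := 1) fun n hn => by simp; omega) hg
  convert this using 1
  ext e
  rw [powerSeriesMul_single]

lemma subset_powerSeriesSpan (S : Set ComplexPowerSeries) : S ⊆ powerSeriesSpan S := by
  intro g hg
  simpa using shift_mem_powerSeriesSpan 0 hg

/-- Multiplication by a power series is a `finsum`, which is additive only for finite supports;
truncation supplies these. -/
lemma powerSeriesSpan_span_le (S : Set ComplexPowerSeries) (hS : S ⊆ truncatedSeries) :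
    powerSeriesSpan (Submodule.span ℂ S) ≤ powerSeriesSpan S := by
  refine Submodule.span_le.2 ?_
  rintro _ ⟨P, q, hq, g, hg, rfl⟩
  have hT : ∀ g ∈ Submodule.span ℂ S, g ∈ truncatedSeries := fun g hg =>
    Submodule.span_le.2 hS hg
  have hsum : ∀ g ∈ truncatedSeries, ∀ e : ℂ × ℂ, (Function.support fun n : ℕ =>
      q n * g (e.1 + ((P + n : ℕ) : ℂ), e.2 - ((P + n : ℕ) : ℂ))).Finite := by
    intro g hg e
    obtain ⟨N, hN⟩ := hg e
    refine (Finset.range N).finite_toSet.subset fun n hn => ?_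
    by_contra h'
    refine hn ?_
    have : N ≤ n := by simpa using h'
    simp only
    rw [hN (P + n) (by omega), mul_zero]
  rw [SetLike.mem_coe]
  induction hg using Submodule.span_induction with
  | mem x h => exact powerSeriesMul_mem_span P hq h
  | zero =>
    convert zero_mem (powerSeriesSpan S) using 1
    ext e; simp [powerSeriesMul]
  | add x y hx hy h1 h2 =>
    convert add_mem h1 h2 using 1
    ext e
    simp only [powerSeriesMul, Pi.add_apply, mul_add]
    exact finsum_add_distrib (hsum x (hT x hx) e) (hsum y (hT y hy) e)
  | smul a x hx h1 =>
    convert Submodule.smul_mem _ a h1 using 1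
    ext e
    simp only [powerSeriesMul, Pi.smul_apply, smul_eq_mul]
    rw [← smul_eq_mul a, smul_finsum' _ (hsum x (hT x hx) e)]
    exact finsum_congr fun n => by simp; ring

/-- Coordinates of a member of the span with respect to a finite generating family. -/
lemma exists_coord_of_mem_powerSeriesSpan {ι : Type*} [Fintype ι] {g : ι → ComplexPowerSeries}
    {f : ComplexPowerSeries}
    (hf : f ∈ powerSeriesSpan (Set.range g)) :
    ∃ p : ι → ℕ → ℂ, (∀ i, p i ∈ polyBounded) ∧
      ∀ (e : ℂ × ℂ) (N : ℕ), (∀ i, ∀ n, N ≤ n → g i (e.1 + n, e.2 - n) = 0) →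
        f e = ∑ i, ∑ n ∈ Finset.range N, p i n * g i (e.1 + n, e.2 - n) := by
  classical
  induction hf using Submodule.span_induction with
  | mem x h =>
    obtain ⟨P, q, ⟨C, k, hC, hq⟩, _, ⟨i, rfl⟩, rfl⟩ := h
    -- The factor (Y/X)^P is absorbed by padding q with P zeros; the polynomial bound survives
    -- because n - P ≤ n.
    refine ⟨Pi.single i fun n => if P ≤ n then q (n - P) else 0, fun j => ?_, fun e N hN => ?_⟩
    · rcases eq_or_ne j i with rfl | hj
      · rw [Pi.single_eq_same]
        refine ⟨C, k, hC, fun n => ?_⟩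
        beta_reduce
        split_ifs with h
        · refine (hq _).trans ?_
          gcongr
          omega
        · simp; positivity
      · rw [Pi.single_eq_of_ne hj]; exact zero_mem _
    · rw [Finset.sum_eq_single i (fun j _ hj => by simp [Pi.single_eq_of_ne hj]) (by simp)]
      rw [Pi.single_eq_same, powerSeriesMul,
        finsum_eq_sum_range (N := N) fun n hn => by rw [hN i _ (by omega), mul_zero]]
      have h1 : ∑ n ∈ Finset.range N, (if P ≤ n then q (n - P) else 0) * g i (e.1 + n, e.2 - n) =
          ∑ n ∈ Finset.range (P + N),
            (if P ≤ n then q (n - P) else 0) * g i (e.1 + n, e.2 - n) := by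
        refine Finset.sum_subset (Finset.range_mono (by omega)) fun n _ hn => ?_
        rw [hN i n (by simpa using hn), mul_zero]
      have h2 : ∑ n ∈ Finset.range P,
          (if P ≤ n then q (n - P) else 0) * g i (e.1 + n, e.2 - n) = 0 :=
        Finset.sum_eq_zero fun n hn => by rw [if_neg (by simpa using hn), zero_mul]
      rw [h1, Finset.sum_range_add, h2, zero_add]
      simp
  | zero => exact ⟨0, fun _ => zero_mem _, fun e N _ => by simp⟩
  | add x y hx hy h1 h2 =>
    obtain ⟨p, hp, h1⟩ := h1
    obtain ⟨p', hp', h2⟩ := h2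
    refine ⟨p + p', fun i => add_mem (hp i) (hp' i), fun e N hN => ?_⟩
    simp [h1 e N hN, h2 e N hN, add_mul, Finset.sum_add_distrib]
  | smul a x hx h1 =>
    obtain ⟨p, hp, h1⟩ := h1
    refine ⟨a • p, fun i => Submodule.smul_mem _ a (hp i), fun e N hN => ?_⟩
    simp [h1 e N hN, mul_assoc, Finset.mul_sum]

/-! ### Regular singular systems: exponents and growth of formal solutions. -/

/-- A sequence governed by a recursion of regular singular type grows subexponentially. -/
lemma exists_bound_of_regular_recursion {u K : ℕ → ℝ} {β ρ : ℝ} (hu : ∀ n, 0 ≤ u n)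
    (hK : ∀ n, 0 ≤ K n) (hρ : 0 < ρ) (hs : Summable fun n => K n * ρ ^ n)
    (h : ∀ n : ℕ, (n - β) * u n ≤ ∑ k ∈ Finset.range (n + 1), K k * u (n - k)) :
    ∃ C, ∀ n, u n * ρ ^ n ≤ C := by
  set T := ∑' n, K n * ρ ^ n with hT
  have hT0 : 0 ≤ T := tsum_nonneg fun n => mul_nonneg (hK n) (by positivity)
  -- For n > N one has n - β > T. If u n * ρ ^ n exceeded C, it would dominate all earlier weighted
  -- terms, and the recursion would give n - β ≤ T.
  obtain ⟨N, hN⟩ := exists_nat_gt (β + T)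
  set C := ∑ n ∈ Finset.range (N + 1), u n * ρ ^ n with hC
  have hC0 : 0 ≤ C := Finset.sum_nonneg fun n _ => mul_nonneg (hu n) (by positivity)
  refine ⟨C, fun n => ?_⟩
  induction n using Nat.strong_induction_on with
  | _ n ih =>
    rcases le_or_gt n N with hn | hn
    · exact Finset.single_le_sum (f := fun n => u n * ρ ^ n)
        (fun n _ => mul_nonneg (hu n) (by positivity)) (Finset.mem_range.2 (by omega))
    by_contra! hcon
    have hw : ∀ k ∈ Finset.range (n + 1), u (n - k) * ρ ^ (n - k) ≤ u n * ρ ^ n := by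
      intro k hk
      rcases Nat.eq_zero_or_pos k with rfl | hk0
      · simp
      · exact (ih (n - k) (by omega)).trans hcon.le
    have h1 : (n - β) * (u n * ρ ^ n) ≤ T * (u n * ρ ^ n) := by
      calc (n - β) * (u n * ρ ^ n) = ((n - β) * u n) * ρ ^ n := by ring
        _ ≤ (∑ k ∈ Finset.range (n + 1), K k * u (n - k)) * ρ ^ n := by
            gcongr; exact h n
        _ = ∑ k ∈ Finset.range (n + 1), (K k * ρ ^ k) * (u (n - k) * ρ ^ (n - k)) := by
            rw [Finset.sum_mul]
            refine Finset.sum_congr rfl fun k hk => ?_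
            have : ρ ^ n = ρ ^ k * ρ ^ (n - k) := by
              rw [← pow_add]; congr 1; have := Finset.mem_range.1 hk; omega
            rw [this]; ring
        _ ≤ ∑ k ∈ Finset.range (n + 1), (K k * ρ ^ k) * (u n * ρ ^ n) :=
            Finset.sum_le_sum fun k hk =>
              mul_le_mul_of_nonneg_left (hw k hk) (mul_nonneg (hK k) (by positivity))
        _ = (∑ k ∈ Finset.range (n + 1), K k * ρ ^ k) * (u n * ρ ^ n) := by
            rw [Finset.sum_mul]
        _ ≤ T * (u n * ρ ^ n) := by
            refine mul_le_mul_of_nonneg_right ?_ (mul_nonneg (hu n) (by positivity))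
            exact hs.sum_le_tsum _ fun k _ => mul_nonneg (hK k) (by positivity)
    have h2 : (N : ℝ) < n := by exact_mod_cast hn
    have h3 : 0 < u n * ρ ^ n := lt_of_le_of_lt hC0 hcon
    have := le_of_mul_le_mul_right h1 h3
    linarith

/-- Supported on finitely many strings `(a - n, b + n)`, `n ≥ 0`, with coefficients of
subexponential growth in `n`. -/
def IsStringConvergent (g : ComplexPowerSeries) : Prop :=
  ∃ E : Finset (ℂ × ℂ), (∀ e, g e ≠ 0 → ∃ l ∈ E, ∃ n : ℕ, e = (l.1 - n, l.2 + n)) ∧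
    ∀ ρ : ℝ, 0 < ρ → ρ < 1 → ∀ l ∈ E, ∃ C : ℝ, ∀ n : ℕ, ‖g (l.1 - n, l.2 + n)‖ * ρ ^ n ≤ C

/-- This is used as the indicial equation: M will be the constant term of the matrix of an Euler
operator, and μ a leading exponent. -/
lemma finite_setOf_eigenvector {ι : Type*} [Fintype ι] (M : ι → ι → ℂ) :
    {μ : ℂ | ∃ x : ι → ℂ, x ≠ 0 ∧ ∀ i, μ * x i = ∑ j, M i j * x j}.Finite := by
  classical
  refine (Module.End.finite_hasEigenvalue (Matrix.toLin' (Matrix.of M))).subset ?_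
  rintro μ ⟨x, hx, h⟩
  refine Module.End.hasEigenvalue_of_hasEigenvector (x := x) ⟨?_, hx⟩
  rw [Module.End.mem_eigenspace_iff, Matrix.toLin'_apply]
  ext i
  simp [Matrix.mulVec, dotProduct, h i]

/-- Frobenius' method on formal series. In a basis of S the Euler operators become matrices p and q
of power series in Y/X. Their constant terms determine the possible leading exponents, and the
higher terms of q give a recursion along each string. -/
theorem isStringConvergent_of_differential_system (S : Submodule ℂ ComplexPowerSeries)
    [FiniteDimensional ℂ S] (hS : S ≤ truncatedSeries)
    (h₁ : ∀ g ∈ S, (fun e => e.1 * g e) ∈ powerSeriesSpan S)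
    (h₂ : ∀ g ∈ S, (fun e => e.2 * g e) ∈ powerSeriesSpan S) :
    ∀ g ∈ S, IsStringConvergent g := by
  classical
  set b := Module.finBasis ℂ S
  set x : Fin (Module.finrank ℂ S) → ComplexPowerSeries := fun i => (b i : ComplexPowerSeries)
    with hx
  have hxS : ∀ i, x i ∈ S := fun i => (b i).2
  have hxT : ∀ i, x i ∈ truncatedSeries := fun i => hS (hxS i)
  have hspan : Submodule.span ℂ (Set.range x) = S := by
    have : x = S.subtype ∘ b := rfl
    rw [this, Set.range_comp, Submodule.span_image, b.span_eq]
    simp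
  have hle : powerSeriesSpan S ≤ powerSeriesSpan (Set.range x) := by
    conv_lhs => rw [← hspan]
    exact powerSeriesSpan_span_le _ (by rintro _ ⟨i, rfl⟩; exact hxT i)
  choose p hp hpe using fun i => exists_coord_of_mem_powerSeriesSpan (hle (h₁ _ (hxS i)))
  choose q hq hqe using fun i => exists_coord_of_mem_powerSeriesSpan (hle (h₂ _ (hxS i)))
  have hE₁ := finite_setOf_eigenvector fun i j => p i j 0
  have hE₂ := finite_setOf_eigenvector fun i j => q i j 0
  set E : Finset (ℂ × ℂ) := (hE₁.toFinset ×ˢ hE₂.toFinset).filter fun l =>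
    ∀ i, ∀ n : ℕ, 1 ≤ n → x i (l.1 + n, l.2 - n) = 0 with hE
  have hsupp : ∀ e, (∃ i, x i e ≠ 0) → ∃ l ∈ E, ∃ n : ℕ, e = (l.1 - n, l.2 + n) := by
    rintro e ⟨i₀, hi₀⟩
    have hex : ∃ N : ℕ, ∀ i, ∀ n : ℕ, N ≤ n → x i (e.1 + n, e.2 - n) = 0 := by
      choose N hN using fun i => hxT i e
      exact ⟨Finset.univ.sup N, fun i n hn =>
        hN i n ((Finset.le_sup (Finset.mem_univ i)).trans hn)⟩
    -- Going from e in the direction (1, -1), all basis elements vanish from step N on but not all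
    -- at step N - 1; that last point l is the leading exponent of the string.
    set N := Nat.find hex with hNdef
    have hN := Nat.find_spec hex
    have hN0 : N ≠ 0 := by
      intro h0
      have := hN i₀ 0 (by omega)
      simp at this
      exact hi₀ this
    obtain ⟨n₀, hn₀⟩ := Nat.exists_eq_succ_of_ne_zero hN0
    have hmin := Nat.find_min hex (m := n₀) (by omega)
    set l : ℂ × ℂ := (e.1 + n₀, e.2 - n₀) with hl
    have hlead : ∀ i, ∀ n : ℕ, 1 ≤ n → x i (l.1 + n, l.2 - n) = 0 := by
      intro i n hn
      have := hN i (n₀ + n) (by omega)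
      rw [← this]
      congr 1
      ext <;> simp [hl] <;> ring
    have hne : (fun i => x i l) ≠ 0 := by
      intro h0
      refine hmin fun i n hn => ?_
      rcases Nat.lt_or_ge n₀ n with h' | h'
      · exact hN i n (by omega)
      · obtain rfl : n = n₀ := by omega
        exact congrFun h0 i
    refine ⟨l, ?_, n₀, by ext <;> simp [hl]⟩
    rw [hE, Finset.mem_filter, Finset.mem_product, Set.Finite.mem_toFinset,
      Set.Finite.mem_toFinset]
    -- At l only the constant terms of p and q contribute, so the vector of coefficients at l is an
    -- eigenvector of both, with eigenvalues l.1 and l.2.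
    refine ⟨⟨⟨fun i => x i l, hne, fun i => ?_⟩, ⟨fun i => x i l, hne, fun i => ?_⟩⟩, hlead⟩
    · simpa using hpe i l 1 hlead
    · simpa using hqe i l 1 hlead
  have hbound : ∀ ρ : ℝ, 0 < ρ → ρ < 1 → ∀ l ∈ E, ∃ C : ℝ, ∀ i, ∀ n : ℕ,
      ‖x i (l.1 - n, l.2 + n)‖ * ρ ^ n ≤ C := by
    intro ρ h0 h1 l hl
    have hlead := (Finset.mem_filter.1 hl).2
    set u : ℕ → ℝ := fun n => ∑ i, ‖x i (l.1 - n, l.2 + n)‖ with hu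
    set K : ℕ → ℝ := fun n => ∑ i, ∑ j, ‖q i j n‖ with hK
    have hKs : Summable fun n => K n * ρ ^ n := by
      simp only [hK, Finset.sum_mul]
      exact summable_sum fun i _ => summable_sum fun j _ =>
        summable_norm_mul_pow_of_mem_polyBounded (hq i j) h0 h1
    have hu0 : ∀ n, 0 ≤ u n := fun n => Finset.sum_nonneg fun i _ => norm_nonneg _
    -- The Euler operator of Y alone suffices: on the string it multiplies by l.2 + n, whose norm is
    -- at least n - ‖l.2‖.
    obtain ⟨C, hC⟩ := exists_bound_of_regular_recursion (β := ‖l.2‖) hu0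
      (fun n => Finset.sum_nonneg fun i _ => Finset.sum_nonneg fun j _ => norm_nonneg _)
      h0 hKs (fun n => by
        have hrec : ∀ i, (n - ‖l.2‖) * ‖x i (l.1 - n, l.2 + n)‖ ≤
            ∑ k ∈ Finset.range (n + 1), ∑ j, ‖q i j k‖ * u (n - k) := by
          intro i
          have he := hqe i (l.1 - n, l.2 + n) (n + 1) (fun j m hm => by
            have := hlead j (m - n) (by omega)
            rw [← this]
            congr 1
            rw [Nat.cast_sub (by omega)]
            ext <;> simp <;> ring)
          calc (n - ‖l.2‖) * ‖x i (l.1 - n, l.2 + n)‖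
              ≤ ‖l.2 + n‖ * ‖x i (l.1 - n, l.2 + n)‖ := by
                gcongr
                have := norm_sub_le (l.2 + n) l.2
                simp at this
                linarith
            _ = ‖(l.2 + n) * x i (l.1 - n, l.2 + n)‖ := (norm_mul _ _).symm
            _ ≤ ∑ j, ∑ k ∈ Finset.range (n + 1), ‖q i j k‖ * u (n - k) := by
                simp only at he
                rw [he]
                refine (norm_sum_le _ _).trans (Finset.sum_le_sum fun j _ => ?_)
                refine (norm_sum_le _ _).trans (Finset.sum_le_sum fun k hk => ?_)
                rw [norm_mul]
                gcongr
                have hk' : k ≤ n := by have := Finset.mem_range.1 hk; omega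
                have : x j (l.1 - n + k, l.2 + n - k) =
                    x j (l.1 - ((n - k : ℕ) : ℂ), l.2 + ((n - k : ℕ) : ℂ)) := by
                  congr 1
                  rw [Nat.cast_sub hk']
                  ext <;> simp <;> ring
                rw [this]
                exact Finset.single_le_sum
                  (f := fun j => ‖x j (l.1 - ((n - k : ℕ) : ℂ), l.2 + ((n - k : ℕ) : ℂ))‖)
                  (fun _ _ => norm_nonneg _) (Finset.mem_univ j)
            _ = _ := Finset.sum_comm
        calc (n - ‖l.2‖) * u n = ∑ i, (n - ‖l.2‖) * ‖x i (l.1 - n, l.2 + n)‖ := by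
              rw [hu, Finset.mul_sum]
          _ ≤ ∑ i, ∑ k ∈ Finset.range (n + 1), ∑ j, ‖q i j k‖ * u (n - k) :=
              Finset.sum_le_sum fun i _ => hrec i
          _ = ∑ k ∈ Finset.range (n + 1), K k * u (n - k) := by
              rw [Finset.sum_comm]
              simp only [hK, Finset.sum_mul])
    refine ⟨C, fun i n => (mul_le_mul_of_nonneg_right ?_ (by positivity)).trans (hC n)⟩
    exact Finset.single_le_sum (f := fun j => ‖x j (l.1 - n, l.2 + n)‖)
      (fun _ _ => norm_nonneg _) (Finset.mem_univ i)
  intro g hg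
  obtain ⟨c, hc⟩ : ∃ c : Fin (Module.finrank ℂ S) → ℂ, g = ∑ i, c i • x i := by
    refine ⟨b.repr ⟨g, hg⟩, ?_⟩
    have := congrArg S.subtype (b.sum_repr ⟨g, hg⟩)
    rw [map_sum] at this
    exact this.symm
  have hge : ∀ e, g e = ∑ i, c i * x i e := fun e => by simp [hc]
  refine ⟨E, fun e he => hsupp e ?_, fun ρ h0 h1 l hl => ?_⟩
  · by_contra! hcon
    exact he (by rw [hge]; simp [hcon])
  · obtain ⟨C, hC⟩ := hbound ρ h0 h1 l hl
    refine ⟨∑ i, ‖c i‖ * C, fun n => ?_⟩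
    rw [hge]
    calc ‖∑ i, c i * x i (l.1 - n, l.2 + n)‖ * ρ ^ n
        ≤ (∑ i, ‖c i‖ * ‖x i (l.1 - n, l.2 + n)‖) * ρ ^ n := by
          gcongr
          refine (norm_sum_le _ _).trans (Finset.sum_le_sum fun i _ => (norm_mul _ _).le)
      _ = ∑ i, ‖c i‖ * (‖x i (l.1 - n, l.2 + n)‖ * ρ ^ n) := by
          rw [Finset.sum_mul]; exact Finset.sum_congr rfl fun i _ => by ring
      _ ≤ _ := Finset.sum_le_sum fun i _ => by gcongr; exact hC i n

/-! ### From growth along strings to local normal convergence. -/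

theorem IsStringConvergent.locallyNormallyConvergentOn {c : ComplexPowerSeries}
    (hc : IsStringConvergent c) {X Y : ℂ × ℂ → ℂ} {D : Set (ℂ × ℂ)}
    (hD : ∀ p ∈ D, ‖Y p‖ < ‖X p‖) : LocallyNormallyConvergentOn c X Y D := by
  intro K hKD hK lX lY hlX hlY hX hY
  obtain ⟨E, hsupp, hbound⟩ := hc
  have hratio : ∀ p ∈ K, ‖Complex.exp (lY p - lX p)‖ < 1 := by
    intro p hp
    have := hD p (hKD hp)
    rw [Complex.exp_sub, hX p hp, hY p hp, norm_div,
      div_lt_one (lt_of_le_of_lt (norm_nonneg _) this)]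
    exact this
  obtain ⟨r, hr0, hr1, hr⟩ : ∃ r : ℝ, 0 < r ∧ r < 1 ∧
      ∀ p ∈ K, ‖Complex.exp (lY p - lX p)‖ ≤ r := by
    rcases K.eq_empty_or_nonempty with rfl | hne
    · exact ⟨1 / 2, by norm_num, by norm_num, by simp⟩
    · obtain ⟨p, hp, hmax⟩ := hK.exists_isMaxOn hne
        ((hlY.sub hlX).cexp.norm : ContinuousOn (fun p => ‖Complex.exp (lY p - lX p)‖) K)
      exact ⟨_, norm_pos_iff.2 (Complex.exp_ne_zero _), hratio p hp, hmax⟩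
  -- Any ρ strictly between r and 1 works: the coefficients cost ρ^(-n), the monomials supply r^n,
  -- and r/ρ < 1 leaves a geometric series.
  set ρ := (r + 1) / 2 with hρ
  have hρ0 : 0 < ρ := by linarith
  have hρ1 : ρ < 1 := by linarith
  have hB : ∀ l : ℂ × ℂ, ∃ B : ℝ, ∀ p ∈ K, ‖Complex.exp (l.1 * lX p + l.2 * lY p)‖ ≤ B := by
    intro l
    obtain ⟨B, hB⟩ := hK.exists_bound_of_continuousOn
      ((hlX.const_mul l.1).add (hlY.const_mul l.2)).cexp
    exact ⟨B, hB⟩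
  choose B hB using hB
  choose! C hC using fun l hl => hbound ρ hρ0 hρ1 l hl
  have hinj : ∀ l : ℂ × ℂ, Function.Injective fun n : ℕ => (l.1 - (n : ℂ), l.2 + (n : ℂ)) := by
    intro l m n h
    simpa using congrArg Prod.snd h
  set T : ℂ × ℂ → ℕ → ℝ := fun l n => |C l| * |B l| * (r / ρ) ^ n with hT
  have hT0 : ∀ l n, 0 ≤ T l n := fun l n => by positivity
  have hTs : ∀ l, Summable (T l) := fun l =>
    (summable_geometric_of_lt_one (by positivity)
      ((div_lt_one hρ0).2 (by linarith))).mul_left _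
  -- The majorant of a string is extended by zero off the string. Strings may overlap, but for each
  -- exponent a single string through it gives the bound, so the sum over E is a majorant.
  set M : ℂ × ℂ → ℂ × ℂ → ℝ := fun l =>
    Function.extend (fun n : ℕ => (l.1 - (n : ℂ), l.2 + (n : ℂ))) (T l) 0 with hM
  have hM0 : ∀ l e, 0 ≤ M l e := by
    intro l e
    by_cases h : ∃ n : ℕ, (l.1 - (n : ℂ), l.2 + (n : ℂ)) = e
    · obtain ⟨n, rfl⟩ := h
      simp only [hM, (hinj l).extend_apply]
      exact hT0 l n
    · simp only [hM, Function.extend_apply' _ _ _ h]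
      exact le_rfl
  have hMs : ∀ l, Summable (M l) := by
    intro l
    refine ((hinj l).summable_iff fun e he => ?_).1 ?_
    · simp only [hM]
      rw [Function.extend_apply' _ _ _ he, Pi.zero_apply]
    · have : M l ∘ (fun n : ℕ => (l.1 - (n : ℂ), l.2 + (n : ℂ))) = T l := by
        ext n
        simp only [hM, Function.comp_apply, (hinj l).extend_apply]
      rw [this]
      exact hTs l
  refine ⟨fun e => ∑ l ∈ E, M l e, summable_sum fun l _ => hMs l, fun e p hp => ?_⟩
  by_cases he : c e = 0
  · rw [he, zero_mul, norm_zero]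
    exact Finset.sum_nonneg fun l _ => hM0 l e
  obtain ⟨l, hl, n, rfl⟩ := hsupp e he
  refine le_trans ?_ (Finset.single_le_sum (fun l _ => hM0 l _) hl)
  simp only [hM, (hinj l).extend_apply]
  have h1 : (l.1 - (n : ℂ)) * lX p + (l.2 + (n : ℂ)) * lY p =
      (l.1 * lX p + l.2 * lY p) + n * (lY p - lX p) := by ring
  rw [h1, Complex.exp_add, Complex.exp_nat_mul, norm_mul, norm_mul, norm_pow]
  have h2 := hC l hl n
  have h3 : ‖c (l.1 - n, l.2 + n)‖ ≤ |C l| / ρ ^ n := by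
    rw [le_div_iff₀ (by positivity)]
    exact h2.trans (le_abs_self _)
  calc ‖c (l.1 - n, l.2 + n)‖ * (‖Complex.exp (l.1 * lX p + l.2 * lY p)‖ *
        ‖Complex.exp (lY p - lX p)‖ ^ n) ≤ |C l| / ρ ^ n * (|B l| * r ^ n) := by
        gcongr
        · exact (hB l p hp).trans (le_abs_self _)
        · exact hr p hp
    _ = T l n := by
        clear_value ρ
        simp only [hT]
        rw [div_pow]
        ring

lemma LocallyNormallyConvergentOn.add {c c' X Y : ℂ × ℂ → ℂ} {D : Set (ℂ × ℂ)}
    (h : LocallyNormallyConvergentOn c X Y D) (h' : LocallyNormallyConvergentOn c' X Y D) :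
    LocallyNormallyConvergentOn (c + c') X Y D := by
  intro K hKD hK lX lY hlX hlY hX hY
  obtain ⟨M, hM, hb⟩ := h K hKD hK lX lY hlX hlY hX hY
  obtain ⟨M', hM', hb'⟩ := h' K hKD hK lX lY hlX hlY hX hY
  refine ⟨fun e => M e + M' e, hM.add hM', fun e p hp => ?_⟩
  rw [Pi.add_apply, add_mul]
  exact (norm_add_le _ _).trans (add_le_add (hb e p hp) (hb' e p hp))

lemma LocallyNormallyConvergentOn.zero {X Y : ℂ × ℂ → ℂ} {D : Set (ℂ × ℂ)} :
    LocallyNormallyConvergentOn 0 X Y D :=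
  fun _ _ _ _ _ _ _ _ _ => ⟨0, summable_zero, fun e p _ => by simp⟩

lemma LocallyNormallyConvergentOn.sum {ι : Type*} {s : Finset ι} {c : ι → ℂ × ℂ → ℂ}
    {X Y : ℂ × ℂ → ℂ} {D : Set (ℂ × ℂ)}
    (h : ∀ i ∈ s, LocallyNormallyConvergentOn (c i) X Y D) :
    LocallyNormallyConvergentOn (∑ i ∈ s, c i) X Y D :=
  Finset.sum_induction c (LocallyNormallyConvergentOn · X Y D) (fun _ _ => .add) .zero h

/-- A shift of the exponents is multiplication by a fixed monomial, which is bounded on compact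
sets. This removes the normalization by degrees. -/
lemma LocallyNormallyConvergentOn.shift {c X Y : ℂ × ℂ → ℂ} {D : Set (ℂ × ℂ)}
    (h : LocallyNormallyConvergentOn c X Y D) (δ : ℂ × ℂ) :
    LocallyNormallyConvergentOn (fun e => c (e + δ)) X Y D := by
  intro K hKD hK lX lY hlX hlY hX hY
  obtain ⟨M, hM, hb⟩ := h K hKD hK lX lY hlX hlY hX hY
  obtain ⟨B, hB⟩ := hK.exists_bound_of_continuousOn
    ((hlX.const_mul (-δ.1)).add (hlY.const_mul (-δ.2))).cexp
  refine ⟨fun e => |B| * M (e + δ), ((Equiv.addRight δ).summable_iff.2 hM).mul_left _,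
    fun e p hp => ?_⟩
  have h1 : e.1 * lX p + e.2 * lY p = (-δ.1 * lX p + -δ.2 * lY p) +
      ((e + δ).1 * lX p + (e + δ).2 * lY p) := by
    simp only [Prod.fst_add, Prod.snd_add]; ring
  rw [h1, Complex.exp_add, mul_left_comm, norm_mul]
  exact mul_le_mul ((hB p hp).trans (le_abs_self _)) (hb _ p hp) (norm_nonneg _) (abs_nonneg _)

/-- Needed for iterates: these are expanded in (x - y)/y, so their family lists the exponent of y
first. -/
lemma LocallyNormallyConvergentOn.swap {c X Y : ℂ × ℂ → ℂ} {D : Set (ℂ × ℂ)}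
    (h : LocallyNormallyConvergentOn c X Y D) :
    LocallyNormallyConvergentOn (fun e => c e.swap) Y X D := by
  intro K hKD hK lY lX hlY hlX hY hX
  obtain ⟨M, hM, hb⟩ := h K hKD hK lX lY hlX hlY hX hY
  refine ⟨fun e => M e.swap, (Equiv.prodComm ℂ ℂ).summable_iff.2 hM, fun e p hp => ?_⟩
  have := hb e.swap p hp
  rwa [Prod.fst_swap, Prod.snd_swap, add_comm] at this

/-! ### Graded modules and C_1-cofiniteness. -/

lemma conf_mem_weightSpace (V : Type u) [AddCommGroup V] [Module ℂ V] [VertexOperatorAlgebra V] :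
    VertexOperatorAlgebra.conf ∈ weightSpace V 2 := by
  -- The relation [L(0), L(-2)] = 2 L(-2) on the vacuum, where L(-2) gives ω and L(0) gives 0.
  have h := VertexOperatorAlgebra.virasoro (V := V) 0 (-2) VertexOperatorAlgebra.vac
  norm_num [VertexOperatorAlgebra.creation, VertexOperatorAlgebra.mode_vac] at h
  rw [weightSpace, Module.End.mem_eigenspace_iff, h]
  norm_num

namespace NGrading

variable {V : Type u} [AddCommGroup V] [Module ℂ V] [VertexOperatorAlgebra V]
  {W : Type u} [AddCommGroup W] [Module ℂ W] [VOAModule V W] (g : NGrading V W)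

/-- The projection to the piece of degree `n`. -/
noncomputable def proj (n : ℕ) : W →ₗ[ℂ] W :=
  letI := g.isInternal.chooseDecomposition
  (g.piece n).subtype ∘ₗ DirectSum.component ℂ ℕ (fun n => g.piece n) n ∘ₗ
    (DirectSum.decomposeLinearEquiv g.piece).toLinearMap

lemma proj_mem (n : ℕ) (w : W) : g.proj n w ∈ g.piece n :=
  SetLike.coe_mem _

lemma proj_of_mem {n : ℕ} {w : W} (hw : w ∈ g.piece n) : g.proj n w = w := by
  let := g.isInternal.chooseDecomposition
  exact DirectSum.decompose_of_mem_same g.piece hw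

lemma proj_of_mem_ne {m n : ℕ} {w : W} (hw : w ∈ g.piece m) (h : m ≠ n) : g.proj n w = 0 := by
  let := g.isInternal.chooseDecomposition
  exact DirectSum.decompose_of_mem_ne g.piece hw h

lemma exists_sum_proj (w : W) : ∃ s : Finset ℕ, ∑ n ∈ s, g.proj n w = w := by
  let := g.isInternal.chooseDecomposition
  classical
  exact ⟨_, DirectSum.sum_support_decompose g.piece w⟩

/-- The elements of degree `n` that `C_1(W)` contains for degree reasons. -/
def c1Piece (n : ℕ) : Submodule ℂ W :=
  Submodule.span ℂ {x | ∃ d m : ℕ, 1 ≤ d ∧ d + m = n ∧ ∃ a ∈ weightSpace V d, ∃ w ∈ g.piece m,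
    x = VOAModule.act a (-1) w}

/-- C_1(W) is a graded subspace: for a of weight d the mode a_{-1} raises degrees by exactly d, so
splitting w into homogeneous parts splits a_{-1}w. -/
lemma proj_mem_c1Piece {x : W} (hx : x ∈ C1Subspace V W) (n : ℕ) : g.proj n x ∈ g.c1Piece n := by
  induction hx using Submodule.span_induction with
  | mem x h =>
    obtain ⟨d, hd, a, ha, w, rfl⟩ := h
    obtain ⟨s, hs⟩ := g.exists_sum_proj w
    rw [← hs, map_sum, map_sum]
    refine Submodule.sum_mem _ fun m _ => ?_
    lift d to ℕ using by omega
    have hm := (g.act_mem d a ha (-1) m _ (g.proj_mem m w)).1 (d + m) (by push_cast; ring)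
    rcases eq_or_ne (d + m) n with h | h
    · rw [← h, g.proj_of_mem hm]
      exact Submodule.subset_span ⟨d, m, by omega, rfl, a, ha, _, g.proj_mem m w, rfl⟩
    · rw [g.proj_of_mem_ne hm h]
      exact zero_mem _
  | zero => simp
  | add x y _ _ h1 h2 => rw [map_add]; exact add_mem h1 h2
  | smul c x _ h1 => rw [map_smul]; exact Submodule.smul_mem _ c h1

/-- Choose in each failing degree a vector outside C_1(W). Vectors of distinct degrees stay
independent modulo the graded subspace C_1(W), so only finitely many degrees can fail. -/
lemma exists_piece_le_c1Piece (h : FiniteDimensional ℂ (W ⧸ C1Subspace V W)) :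
    ∃ N : ℕ, ∀ n, N < n → g.piece n ≤ g.c1Piece n := by
  set bad : Set ℕ := {n | ¬ g.piece n ≤ g.c1Piece n} with hbad
  have hx : ∀ n : bad, ∃ x ∈ g.piece n, x ∉ g.c1Piece n := fun n => Set.not_subset.1 n.2
  choose x hxp hxc using hx
  have hli : LinearIndependent ℂ fun n : bad => (C1Subspace V W).mkQ (x n) := by
    rw [linearIndependent_iff']
    intro s c hs n hn
    by_contra hc
    have h1 : ∑ i ∈ s, c i • x i ∈ C1Subspace V W := by
      rw [← Submodule.ker_mkQ (C1Subspace V W), LinearMap.mem_ker, map_sum]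
      simpa using hs
    have h2 := g.proj_mem_c1Piece h1 n
    rw [map_sum, Finset.sum_eq_single n, map_smul, g.proj_of_mem (hxp n)] at h2
    · refine hxc n ?_
      have := Submodule.smul_mem _ (c n)⁻¹ h2
      rwa [smul_smul, inv_mul_cancel₀ hc, one_smul] at this
    · intro m _ hm
      rw [map_smul, g.proj_of_mem_ne (hxp m) fun h => hm (Subtype.ext h), smul_zero]
    · exact fun h => absurd hn h
  have hfin : bad.Finite := by
    have := hli.finite_of_isNoetherian
    exact Set.toFinite bad
  obtain ⟨N, hN⟩ := hfin.bddAbove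
  refine ⟨N, fun n hn => ?_⟩
  by_contra hcon
  exact absurd (hN hcon) (by omega)

/-- Modulo C_1(W) the piece is finite-dimensional by hypothesis. Its part inside C_1(W) lies in the
image of the spaces V_d ⊗ W_(n-d) with 1 ≤ d ≤ n, to which induction applies. -/
lemma fg_piece (h : FiniteDimensional ℂ (W ⧸ C1Subspace V W)) (n : ℕ) : (g.piece n).FG := by
  induction n using Nat.strong_induction_on with
  | _ n ih =>
    have hc : (g.c1Piece n).FG := by
      have hle : g.c1Piece n = ⨆ d ∈ Finset.Icc 1 n,
          Submodule.map₂ (LinearMap.mk₂ ℂ (fun (a : V) (w : W) => VOAModule.act a (-1) w)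
            (by simp) (by simp) (by simp) (by simp)) (weightSpace V d) (g.piece (n - d)) := by
        apply le_antisymm
        · refine Submodule.span_le.2 ?_
          rintro _ ⟨d, m, hd, rfl, a, ha, w, hw, rfl⟩
          refine Submodule.mem_iSup_of_mem d (Submodule.mem_iSup_of_mem
            (Finset.mem_Icc.2 ⟨hd, by omega⟩) ?_)
          exact Submodule.apply_mem_map₂ (LinearMap.mk₂ ℂ
            (fun (a : V) (w : W) => VOAModule.act a (-1) w)
            (by simp) (by simp) (by simp) (by simp)) ha (by simpa using hw)
        · refine iSup₂_le fun d hd => Submodule.map₂_le.2 fun a ha w hw => ?_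
          rw [Finset.mem_Icc] at hd
          exact Submodule.subset_span ⟨d, n - d, hd.1, by omega, a, ha, w, hw, rfl⟩
      rw [hle]
      refine Submodule.fg_biSup _ _ fun d hd => ?_
      rw [Finset.mem_Icc] at hd
      refine Submodule.FG.map₂ _ ?_ (ih (n - d) (by omega))
      have := VertexOperatorAlgebra.finite_weight (V := V) d
      exact (Submodule.fg_iff_finiteDimensional _).2 this
    refine Submodule.fg_of_fg_map_of_fg_inf_ker (C1Subspace V W).mkQ ?_ ?_
    · exact IsNoetherian.noetherian _
    · rw [Submodule.ker_mkQ]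
      have : FiniteDimensional ℂ (g.c1Piece n) := (Submodule.fg_iff_finiteDimensional _).1 hc
      refine (Submodule.fg_iff_finiteDimensional _).2
        (Submodule.finiteDimensional_of_le (S₂ := g.c1Piece n) fun x hx => ?_)
      rw [← g.proj_of_mem hx.1]
      exact g.proj_mem_c1Piece hx.2 n

end NGrading

/-! ### Functionals concentrated in one degree. -/

namespace NGrading

variable {V : Type u} [AddCommGroup V] [Module ℂ V] [VertexOperatorAlgebra V]
  {W : Type u} [AddCommGroup W] [Module ℂ W] [VOAModule V W] (g : NGrading V W)

/-- The functionals concentrated in degree `m`. -/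
def dualPiece (m : ℕ) : Submodule ℂ (Module.Dual ℂ W) where
  carrier := {θ | ∀ i, i ≠ m → ∀ w ∈ g.piece i, θ w = 0}
  add_mem' := fun h h' i hi w hw => by simp [h i hi w hw, h' i hi w hw]
  zero_mem' := fun _ _ _ _ => rfl
  smul_mem' := fun c θ h i hi w hw => by simp [h i hi w hw]

lemma dual_ext {θ θ' : Module.Dual ℂ W} (h : ∀ i, ∀ w ∈ g.piece i, θ w = θ' w) : θ = θ' := by
  ext w
  obtain ⟨s, hs⟩ := g.exists_sum_proj w
  rw [← hs, map_sum, map_sum]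
  exact Finset.sum_congr rfl fun n _ => h n _ (g.proj_mem n w)

/-- The mode a_k changes degrees by d - k - 1, so the index d - n - 2 parametrizes the strictly
raising modes by n ≥ 0. -/
lemma act_raise_mem {d : ℤ} {a : V} (ha : a ∈ weightSpace V d) (n : ℕ) {i : ℕ} {w : W}
    (hw : w ∈ g.piece i) : VOAModule.act a (d - n - 2) w ∈ g.piece (i + n + 1) :=
  (g.act_mem d a ha _ i w hw).1 _ (by push_cast; ring)

lemma comp_act_mem_dualPiece {m n : ℕ} (hn : n < m) {θ : Module.Dual ℂ W}
    (hθ : θ ∈ g.dualPiece m) {d : ℤ} {a : V} (ha : a ∈ weightSpace V d) :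
    θ ∘ₗ VOAModule.act a (d - n - 2) ∈ g.dualPiece (m - n - 1) :=
  fun i hi w hw => hθ (i + n + 1) (by omega) _ (g.act_raise_mem ha n hw)

/-- The composite would be concentrated in the negative degree m - n - 1. This is what makes the
functional terms of every reduction finite in number. -/
lemma comp_act_eq_zero {m n : ℕ} (hn : m ≤ n) {θ : Module.Dual ℂ W}
    (hθ : θ ∈ g.dualPiece m) {d : ℤ} {a : V} (ha : a ∈ weightSpace V d) :
    θ ∘ₗ VOAModule.act a (d - n - 2) = 0 :=
  g.dual_ext fun i w hw => hθ (i + n + 1) (by omega) _ (g.act_raise_mem ha n hw)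

end NGrading

/-! ### Reducible families and their differential systems. -/

section Reducible

variable {V : Type u} [AddCommGroup V] [Module ℂ V] [VertexOperatorAlgebra V]
  {A B C Q : Type u}
  [AddCommGroup A] [Module ℂ A] [VOAModule V A] [AddCommGroup B] [Module ℂ B] [VOAModule V B]
  [AddCommGroup C] [Module ℂ C] [VOAModule V C] [AddCommGroup Q] [Module ℂ Q] [VOAModule V Q]

/-- The terms that occur when an `a_{-1}` with `a` of weight `d` is moved away from one of the
three vectors: functionals composed with operators that raise the degree, and vectors acted on by
nonnegative modes of `a`. -/
def lowerTerms (f : ℤ → ℤ → ℤ → ℤ → Module.Dual ℂ Q → A → B → C → ComplexPowerSeries)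
    (m p q r : ℤ) (θ : Module.Dual ℂ Q) (v : A) (u : B) (w : C) (d : ℤ) (a : V) :
    Set ComplexPowerSeries :=
  {s | ∃ n : ℕ, s = f (m - n - 1) p q r (θ ∘ₗ VOAModule.act a (d - n - 2)) v u w ∨
    s = f m (p + d - 1 - n) q r θ (VOAModule.act a n v) u w ∨
    s = f m p (q + d - 1 - n) r θ v (VOAModule.act a n u) w ∨
    s = f m p q (r + d - 1 - n) θ v u (VOAModule.act a n w)}

/-- The terms that occur in the derivatives of the series. -/
def derivTerms (V : Type u) [AddCommGroup V] [Module ℂ V] [VertexOperatorAlgebra V]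
    {A B C Q : Type u}
    [AddCommGroup A] [Module ℂ A] [VOAModule V A] [AddCommGroup B] [Module ℂ B] [VOAModule V B]
    [AddCommGroup C] [Module ℂ C] [VOAModule V C] [AddCommGroup Q] [Module ℂ Q] [VOAModule V Q]
    (f : ℕ → ℕ → ℤ → ℤ → ℤ → ℤ → Module.Dual ℂ Q → A → B → C → ComplexPowerSeries) (h k : ℕ)
    (m p q r : ℤ) (θ : Module.Dual ℂ Q) (v : A) (u : B) (w : C) : Set ComplexPowerSeries :=
  {f h k m p q r θ v u w, f (h + 1) k m p q r θ v u w, f h (k + 1) m p q r θ v u w,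
    f h k (m - 1) p q r (θ ∘ₗ VOAModule.act (VertexOperatorAlgebra.conf (V := V)) 0) v u w,
    f h k m (p + 1) q r θ (VOAModule.act (VertexOperatorAlgebra.conf (V := V)) 0 v) u w,
    f h k m p (q + 1) r θ v (VOAModule.act (VertexOperatorAlgebra.conf (V := V)) 0 u) w,
    f h k m p q (r + 1) θ v u (VOAModule.act (VertexOperatorAlgebra.conf (V := V)) 0 w)}

/-- A family of series, multilinear in a functional and three vectors, for which the modes of `V`
can be moved away from each of the vectors, and which is closed under differentiation. The integer
parameters are the degrees of the functional and of the vectors. -/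
structure IsReducibleFamily (V : Type u) [AddCommGroup V] [Module ℂ V] [VertexOperatorAlgebra V]
    {A B C Q : Type u}
    [AddCommGroup A] [Module ℂ A] [VOAModule V A] [AddCommGroup B] [Module ℂ B] [VOAModule V B]
    [AddCommGroup C] [Module ℂ C] [VOAModule V C] [AddCommGroup Q] [Module ℂ Q] [VOAModule V Q]
    (f : ℕ → ℕ → ℤ → ℤ → ℤ → ℤ → Module.Dual ℂ Q → A → B → C → ComplexPowerSeries) : Prop where
  linear_dual : ∀ h k m p q r v u w, IsLinearMap ℂ fun θ => f h k m p q r θ v u w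
  linear_fst : ∀ h k m p q r θ u w, IsLinearMap ℂ fun v => f h k m p q r θ v u w
  linear_snd : ∀ h k m p q r θ v w, IsLinearMap ℂ fun u => f h k m p q r θ v u w
  linear_trd : ∀ h k m p q r θ v u, IsLinearMap ℂ fun w => f h k m p q r θ v u w
  truncated : ∀ h k m p q r θ v u w, f h k m p q r θ v u w ∈ truncatedSeries
  log_bound : ∃ K : ℕ, ∀ h k, K < h ∨ K < k → ∀ m p q r θ v u w, f h k m p q r θ v u w = 0
  reduce_fst : ∀ h k m p q r θ v u w (d : ℕ) (a : V), 1 ≤ d → a ∈ weightSpace V d →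
    ∀ M : ℕ, (∀ n : ℕ, M ≤ n → θ ∘ₗ VOAModule.act a ((d : ℤ) - n - 2) = 0) →
    f h k m (p + d) q r θ (VOAModule.act a (-1) v) u w ∈
      powerSeriesSpan (lowerTerms (f h k) m p q r θ v u w d a)
  reduce_snd : ∀ h k m p q r θ v u w (d : ℕ) (a : V), 1 ≤ d → a ∈ weightSpace V d →
    ∀ M : ℕ, (∀ n : ℕ, M ≤ n → θ ∘ₗ VOAModule.act a ((d : ℤ) - n - 2) = 0) →
    f h k m p (q + d) r θ v (VOAModule.act a (-1) u) w ∈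
      powerSeriesSpan (lowerTerms (f h k) m p q r θ v u w d a)
  reduce_trd : ∀ h k m p q r θ v u w (d : ℕ) (a : V), 1 ≤ d → a ∈ weightSpace V d →
    ∀ M : ℕ, (∀ n : ℕ, M ≤ n → θ ∘ₗ VOAModule.act a ((d : ℤ) - n - 2) = 0) →
    f h k m p q (r + d) θ v u (VOAModule.act a (-1) w) ∈
      powerSeriesSpan (lowerTerms (f h k) m p q r θ v u w d a)
  deriv_fst : ∀ h k m p q r θ v u w, (fun e => e.1 * f h k m p q r θ v u w e) ∈
    Submodule.span ℂ (derivTerms V f h k m p q r θ v u w)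
  deriv_snd : ∀ h k m p q r θ v u w, (fun e => e.2 * f h k m p q r θ v u w e) ∈
    Submodule.span ℂ (derivTerms V f h k m p q r θ v u w)

lemma IsLinearMap.mem_of_mem_span {E F : Type*} [AddCommGroup E] [Module ℂ E] [AddCommGroup F]
    [Module ℂ F] {f : E → F} (hf : IsLinearMap ℂ f) {s : Set E} {T : Submodule ℂ F}
    (h : ∀ x ∈ s, f x ∈ T) {x : E} (hx : x ∈ Submodule.span ℂ s) : f x ∈ T := by
  have : Submodule.span ℂ s ≤ T.comap hf.mk' := Submodule.span_le.2 h
  exact this hx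

variable {f : ℕ → ℕ → ℤ → ℤ → ℤ → ℤ → Module.Dual ℂ Q → A → B → C → ComplexPowerSeries}

/-- A mode a_n with n ≥ 0 adds at most d - 1 to a degree, so the terms with unchanged functional
have total degree at most L; in the others the functional has smaller degree. Terms whose degree
would be negative vanish. -/
lemma lowerTerms_subset {gA : NGrading V A} {gB : NGrading V B} {gC : NGrading V C}
    {gQ : NGrading V Q} (hf : IsReducibleFamily V f) {S : Submodule ℂ ComplexPowerSeries}
    {h k m p q r d L : ℕ} (hL : p + q + r + d ≤ L + 1) {θ : Module.Dual ℂ Q} {v : A} {u : B} {w : C}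
    {a : V} (hθ : θ ∈ gQ.dualPiece m) (hv : v ∈ gA.piece p) (hu : u ∈ gB.piece q)
    (hw : w ∈ gC.piece r) (ha : a ∈ weightSpace V d)
    (h₁ : ∀ n < m, f h k ((m - n - 1 : ℕ) : ℤ) p q r
      (θ ∘ₗ VOAModule.act a ((d : ℤ) - n - 2)) v u w ∈ S)
    (h₂ : ∀ (p q r : ℕ), p + q + r ≤ L → ∀ v ∈ gA.piece p, ∀ u ∈ gB.piece q,
      ∀ w ∈ gC.piece r, f h k m p q r θ v u w ∈ S) :
    lowerTerms (f h k) m p q r θ v u w d a ⊆ S := by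
  rintro _ ⟨n, rfl | rfl | rfl | rfl⟩
  · rcases lt_or_ge n m with hn | hn
    · have := h₁ n hn
      rwa [show ((m - n - 1 : ℕ) : ℤ) = m - n - 1 by omega] at this
    · rw [gQ.comp_act_eq_zero hn hθ ha, (hf.linear_dual ..).map_zero]
      exact zero_mem _
  · rcases lt_or_ge ((p : ℤ) + d - 1 - n) 0 with hn | hn
    · rw [(gA.act_mem d a ha n p v hv).2 (by omega), (hf.linear_fst ..).map_zero]
      exact zero_mem _
    · obtain ⟨i, hi⟩ := Int.eq_ofNat_of_zero_le hn
      rw [hi]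
      exact h₂ i q r (by omega) _ ((gA.act_mem d a ha n p v hv).1 i (by omega)) _ hu _ hw
  · rcases lt_or_ge ((q : ℤ) + d - 1 - n) 0 with hn | hn
    · rw [(gB.act_mem d a ha n q u hu).2 (by omega), (hf.linear_snd ..).map_zero]
      exact zero_mem _
    · obtain ⟨i, hi⟩ := Int.eq_ofNat_of_zero_le hn
      rw [hi]
      exact h₂ p i r (by omega) _ hv _ ((gB.act_mem d a ha n q u hu).1 i (by omega)) _ hw
  · rcases lt_or_ge ((r : ℤ) + d - 1 - n) 0 with hn | hn
    · rw [(gC.act_mem d a ha n r w hw).2 (by omega), (hf.linear_trd ..).map_zero]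
      exact zero_mem _
    · obtain ⟨i, hi⟩ := Int.eq_ofNat_of_zero_le hn
      rw [hi]
      exact h₂ p q i (by omega) _ hv _ hu _ ((gC.act_mem d a ha n r w hw).1 i (by omega))

/-- The span of the functionals `θ ∘ a_k` with `θ` in `U` and `a` of weight at most `D`, where
`a_k` raises the degree by `n + 1`. -/
def raisedDual (V : Type u) [AddCommGroup V] [Module ℂ V] [VertexOperatorAlgebra V]
    {Q : Type u} [AddCommGroup Q] [Module ℂ Q] [VOAModule V Q]
    (U : Submodule ℂ (Module.Dual ℂ Q)) (D n : ℕ) : Submodule ℂ (Module.Dual ℂ Q) :=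
  ⨆ d ∈ Finset.range (D + 1),
    Submodule.map₂ (LinearMap.mk₂ ℂ
      (fun (θ : Module.Dual ℂ Q) (a : V) => θ ∘ₗ VOAModule.act a ((d : ℤ) - n - 2))
      (fun _ _ _ => LinearMap.add_comp _ _ _) (fun _ _ _ => LinearMap.smul_comp _ _ _)
      (fun _ _ _ => by rw [map_add, Pi.add_apply, LinearMap.comp_add])
      (fun _ _ _ => by rw [map_smul, Pi.smul_apply, LinearMap.comp_smul])) U (weightSpace V d)

lemma fg_raisedDual {U : Submodule ℂ (Module.Dual ℂ Q)} (hU : U.FG) (D n : ℕ) :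
    (raisedDual V U D n).FG := by
  refine Submodule.fg_biSup _ _ fun d _ => Submodule.FG.map₂ _ hU ?_
  have := VertexOperatorAlgebra.finite_weight (V := V) d
  exact (Submodule.fg_iff_finiteDimensional _).2 this

lemma mem_raisedDual {U : Submodule ℂ (Module.Dual ℂ Q)} {D n d : ℕ} (hd : d ≤ D)
    {θ : Module.Dual ℂ Q} (hθ : θ ∈ U) {a : V} (ha : a ∈ weightSpace V d) :
    θ ∘ₗ VOAModule.act a ((d : ℤ) - n - 2) ∈ raisedDual V U D n :=
  Submodule.mem_iSup_of_mem d (Submodule.mem_iSup_of_mem (Finset.mem_range.2 (by omega))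
    (Submodule.apply_mem_map₂ (LinearMap.mk₂ ℂ
      (fun (θ : Module.Dual ℂ Q) (a : V) => θ ∘ₗ VOAModule.act a ((d : ℤ) - n - 2))
      (fun _ _ _ => LinearMap.add_comp _ _ _) (fun _ _ _ => LinearMap.smul_comp _ _ _)
      (fun _ _ _ => by rw [map_add, Pi.add_apply, LinearMap.comp_add])
      (fun _ _ _ => by rw [map_smul, Pi.smul_apply, LinearMap.comp_smul])) hθ ha))

lemma raisedDual_le {gQ : NGrading V Q} {U : Submodule ℂ (Module.Dual ℂ Q)} {m n : ℕ}
    (hU : U ≤ gQ.dualPiece m) (hn : n < m) (D : ℕ) :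
    raisedDual V U D n ≤ gQ.dualPiece (m - n - 1) :=
  iSup₂_le fun _ _ => Submodule.map₂_le.2 fun _ hθ _ ha =>
    gQ.comp_act_mem_dualPiece hn (hU hθ) ha

/-- The values of the family on homogeneous arguments of bounded degree span a
finite-dimensional space. -/
lemma exists_finite_spanning_set {gA : NGrading V A} {gB : NGrading V B} {gC : NGrading V C}
    (hf : IsReducibleFamily V f) (hA : ∀ n, (gA.piece n).FG) (hB : ∀ n, (gB.piece n).FG)
    (hC : ∀ n, (gC.piece n).FG) {U : Submodule ℂ (Module.Dual ℂ Q)} (hU : U.FG) (m L : ℕ) :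
    ∃ T : Set ComplexPowerSeries, T.Finite ∧
      (∀ s ∈ T, ∃ h k p q r : ℕ, p + q + r ≤ L ∧ ∃ θ ∈ U, ∃ v ∈ gA.piece p, ∃ u ∈ gB.piece q,
        ∃ w ∈ gC.piece r, s = f h k m p q r θ v u w) ∧
      ∀ h k p q r : ℕ, p + q + r ≤ L → ∀ θ ∈ U, ∀ v ∈ gA.piece p, ∀ u ∈ gB.piece q,
        ∀ w ∈ gC.piece r, f h k m p q r θ v u w ∈ Submodule.span ℂ T := by
  obtain ⟨K, hK⟩ := hf.log_bound
  choose sA hsA using hA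
  choose sB hsB using hB
  choose sC hsC using hC
  obtain ⟨sU, hsU⟩ := hU
  set I : Finset (ℕ × ℕ × ℕ × ℕ × ℕ) :=
    Finset.range (K + 1) ×ˢ Finset.range (K + 1) ×ˢ Finset.range (L + 1) ×ˢ
      Finset.range (L + 1) ×ˢ Finset.range (L + 1) with hI
  set T : Set ComplexPowerSeries := ⋃ i ∈ {i ∈ I | i.2.2.1 + i.2.2.2.1 + i.2.2.2.2 ≤ L},
    (fun x : Module.Dual ℂ Q × A × B × C =>
      f i.1 i.2.1 m i.2.2.1 i.2.2.2.1 i.2.2.2.2 x.1 x.2.1 x.2.2.1 x.2.2.2) ''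
        ((sU : Set (Module.Dual ℂ Q)) ×ˢ (sA i.2.2.1 : Set A) ×ˢ (sB i.2.2.2.1 : Set B) ×ˢ
          (sC i.2.2.2.2 : Set C)) with hT
  refine ⟨T, ?_, ?_, ?_⟩
  · refine Set.Finite.biUnion (Finset.finite_toSet _) fun i _ => Set.Finite.image _ ?_
    exact (Finset.finite_toSet _).prod ((Finset.finite_toSet _).prod
      ((Finset.finite_toSet _).prod (Finset.finite_toSet _)))
  · intro s hs
    simp only [hT, Set.mem_iUnion] at hs
    obtain ⟨⟨h, k, p, q, r⟩, hi, ⟨θ, v, u, w⟩, ⟨h1, h2, h3, h4⟩, rfl⟩ := hs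
    refine ⟨h, k, p, q, r, (Finset.mem_filter.1 hi).2, θ, ?_, v, ?_, u, ?_, w, ?_, rfl⟩
    · rw [← hsU]; exact Submodule.subset_span h1
    · rw [← hsA]; exact Submodule.subset_span h2
    · rw [← hsB]; exact Submodule.subset_span h3
    · rw [← hsC]; exact Submodule.subset_span h4
  · intro h k p q r hL θ hθ v hv u hu w hw
    by_cases hlog : K < h ∨ K < k
    · rw [hK h k hlog]; exact zero_mem _
    push Not at hlog
    rw [← hsU] at hθ
    rw [← hsA] at hv
    rw [← hsB] at hu
    rw [← hsC] at hw
    refine (hf.linear_dual h k m p q r v u w).mem_of_mem_span (fun θ hθ => ?_) hθ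
    refine (hf.linear_fst h k m p q r θ u w).mem_of_mem_span (fun v hv => ?_) hv
    refine (hf.linear_snd h k m p q r θ v w).mem_of_mem_span (fun u hu => ?_) hu
    refine (hf.linear_trd h k m p q r θ v u).mem_of_mem_span (fun w hw => ?_) hw
    refine Submodule.subset_span ?_
    simp only [hT, Set.mem_iUnion]
    refine ⟨⟨h, k, p, q, r⟩, ?_, ⟨θ, v, u, w⟩, ⟨hθ, hv, hu, hw⟩, rfl⟩
    simp only [hI, Finset.mem_filter, Finset.mem_product, Finset.mem_range]
    omega

/-- Multiplication of the coefficient at `e` by `l e`. -/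
def coeffMul (l : ℂ × ℂ → ℂ) : ComplexPowerSeries →ₗ[ℂ] ComplexPowerSeries where
  toFun s := fun e => l e * s e
  map_add' _ _ := by ext e; simp [mul_add]
  map_smul' _ _ := by ext e; simp [mul_left_comm]

/-- A weight bound above which all homogeneous vectors reduce. -/
lemma exists_common_bound {gA : NGrading V A} {gB : NGrading V B} {gC : NGrading V C}
    (hA : FiniteDimensional ℂ (A ⧸ C1Subspace V A))
    (hB : FiniteDimensional ℂ (B ⧸ C1Subspace V B))
    (hC : FiniteDimensional ℂ (C ⧸ C1Subspace V C)) :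
    ∃ N : ℕ, ∀ n, N < n → gA.piece n ≤ gA.c1Piece n ∧ gB.piece n ≤ gB.c1Piece n ∧
      gC.piece n ≤ gC.c1Piece n := by
  obtain ⟨N₁, h₁⟩ := gA.exists_piece_le_c1Piece hA
  obtain ⟨N₂, h₂⟩ := gB.exists_piece_le_c1Piece hB
  obtain ⟨N₃, h₃⟩ := gC.exists_piece_le_c1Piece hC
  exact ⟨N₁ + N₂ + N₃, fun n hn => ⟨h₁ n (by omega), h₂ n (by omega), h₃ n (by omega)⟩⟩

/-- Total degree L + 1 > 3N forces one of the three vectors to have degree above N, hence to be a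
combination of vectors a_{-1}w. The corresponding reduction applies, with m as bound for the
functional terms. -/
lemma reduce_total_weight {gA : NGrading V A} {gB : NGrading V B} {gC : NGrading V C}
    {gQ : NGrading V Q} (hf : IsReducibleFamily V f) {N : ℕ}
    (hN : ∀ n, N < n → gA.piece n ≤ gA.c1Piece n ∧ gB.piece n ≤ gB.c1Piece n ∧
      gC.piece n ≤ gC.c1Piece n) {S : Submodule ℂ ComplexPowerSeries} {h k m L : ℕ}
    (hL : 3 * N ≤ L) {θ : Module.Dual ℂ Q} (hθ : θ ∈ gQ.dualPiece m)
    (hlower : ∀ p q r d : ℕ, p + q + r + d ≤ L + 1 → ∀ v ∈ gA.piece p, ∀ u ∈ gB.piece q,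
      ∀ w ∈ gC.piece r, ∀ a ∈ weightSpace V d, lowerTerms (f h k) m p q r θ v u w d a ⊆ S)
    {p q r : ℕ} (hpqr : p + q + r = L + 1) {v : A} {u : B} {w : C} (hv : v ∈ gA.piece p)
    (hu : u ∈ gB.piece q) (hw : w ∈ gC.piece r) :
    f h k m p q r θ v u w ∈ powerSeriesSpan S := by
  rcases lt_or_ge N p with hp | hp
  · refine (hf.linear_fst h k m p q r θ u w).mem_of_mem_span (fun x hx => ?_) ((hN p hp).1 hv)
    obtain ⟨d, p', hd, rfl, a, ha, v', hv', rfl⟩ := hx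
    have := powerSeriesSpan_mono (hlower p' q r d (by omega) v' hv' u hu w hw a ha)
      (hf.reduce_fst h k m p' q r θ v' u w d a hd ha m
        fun n hn => gQ.comp_act_eq_zero hn hθ ha)
    rwa [show ((d + p' : ℕ) : ℤ) = p' + d by push_cast; ring]
  rcases lt_or_ge N q with hq | hq
  · refine (hf.linear_snd h k m p q r θ v w).mem_of_mem_span (fun x hx => ?_) ((hN q hq).2.1 hu)
    obtain ⟨d, q', hd, rfl, a, ha, u', hu', rfl⟩ := hx
    have := powerSeriesSpan_mono (hlower p q' r d (by omega) v hv u' hu' w hw a ha)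
      (hf.reduce_snd h k m p q' r θ v u' w d a hd ha m
        fun n hn => gQ.comp_act_eq_zero hn hθ ha)
    rwa [show ((d + q' : ℕ) : ℤ) = q' + d by push_cast; ring]
  · have hr : N < r := by omega
    refine (hf.linear_trd h k m p q r θ v u).mem_of_mem_span (fun x hx => ?_) ((hN r hr).2.2 hw)
    obtain ⟨d, r', hd, rfl, a, ha, w', hw', rfl⟩ := hx
    have := powerSeriesSpan_mono (hlower p q r' d (by omega) v hv u hu w' hw' a ha)
      (hf.reduce_trd h k m p q r' θ v u w' d a hd ha m
        fun n hn => gQ.comp_act_eq_zero hn hθ ha)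
    rwa [show ((d + r' : ℕ) : ℤ) = r' + d by push_cast; ring]

/-- The members of a reducible family lie in finite-dimensional spaces of series that satisfy a
differential system with a regular singularity. -/
theorem IsReducibleFamily.exists_differential_system {gA : NGrading V A} {gB : NGrading V B}
    {gC : NGrading V C} {gQ : NGrading V Q} (hf : IsReducibleFamily V f)
    (hA : FiniteDimensional ℂ (A ⧸ C1Subspace V A))
    (hB : FiniteDimensional ℂ (B ⧸ C1Subspace V B))
    (hC : FiniteDimensional ℂ (C ⧸ C1Subspace V C)) (m : ℕ) :
    ∀ U : Submodule ℂ (Module.Dual ℂ Q), U.FG → U ≤ gQ.dualPiece m → ∀ L : ℕ,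
      ∃ S : Submodule ℂ ComplexPowerSeries, S.FG ∧ S ≤ truncatedSeries ∧
        (∀ s ∈ S, (fun e => e.1 * s e) ∈ powerSeriesSpan S) ∧
        (∀ s ∈ S, (fun e => e.2 * s e) ∈ powerSeriesSpan S) ∧
        ∀ h k p q r : ℕ, p + q + r ≤ L → ∀ θ ∈ U, ∀ v ∈ gA.piece p, ∀ u ∈ gB.piece q,
          ∀ w ∈ gC.piece r, f h k m p q r θ v u w ∈ S := by
  obtain ⟨N, hN⟩ := exists_common_bound (gA := gA) (gB := gB) (gC := gC) hA hB hC
  induction m using Nat.strong_induction_on with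
  | _ m ih =>
  intro U hU hUm L₀
  -- The bound is enlarged so that total degree L + 1, one derivative beyond the generators, is
  -- always reducible.
  obtain ⟨L, hL₀, hL⟩ : ∃ L, L₀ ≤ L ∧ 3 * N ≤ L := ⟨L₀ + 3 * N, by omega, by omega⟩
  obtain ⟨T, hTfin, hTform, hTmem⟩ := exists_finite_spanning_set hf (gA.fg_piece hA)
    (gB.fg_piece hB) (gC.fg_piece hC) hU m L
  -- The induction hypothesis covers the functionals θ ∘ a_k of degree m - n - 1. The bound L + 2
  -- admits all weights that occur: at most L + 1 in a reduction, and 2 for ω.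
  choose! S hSfg hStr hS₁ hS₂ hSmem using fun (n : ℕ) (hn : n < m) =>
    ih (m - n - 1) (by omega) (raisedDual V U (L + 2) n) (fg_raisedDual hU _ _)
      (raisedDual_le hUm hn _) (L + 1)
  set R : Submodule ℂ ComplexPowerSeries :=
    Submodule.span ℂ T ⊔ ⨆ n ∈ Finset.range m, S n with hR
  have hTR : Submodule.span ℂ T ≤ R := le_sup_left
  have hSR : ∀ n < m, S n ≤ R := fun n hn =>
    (le_iSup₂_of_le (f := fun n (_ : n ∈ Finset.range m) => S n) n (Finset.mem_range.2 hn)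
      le_rfl).trans le_sup_right
  have hRle : ∀ M : Submodule ℂ ComplexPowerSeries, (∀ s ∈ T, s ∈ M) → (∀ n < m, S n ≤ M) →
      R ≤ M := fun M h1 h2 => sup_le (Submodule.span_le.2 h1)
    (iSup₂_le fun n hn => h2 n (Finset.mem_range.1 hn))
  have hraise : ∀ h k p q r d n : ℕ, p + q + r ≤ L + 1 → d ≤ L + 2 → n < m → ∀ θ ∈ U,
      ∀ v ∈ gA.piece p, ∀ u ∈ gB.piece q, ∀ w ∈ gC.piece r, ∀ a ∈ weightSpace V d,
      f h k ((m - n - 1 : ℕ) : ℤ) p q r (θ ∘ₗ VOAModule.act a ((d : ℤ) - n - 2)) v u w ∈ R :=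
    fun h k p q r d n hpqr hd hn θ hθ v hv u hu w hw a ha =>
      hSR n hn (hSmem n hn h k p q r hpqr _ (mem_raisedDual hd hθ ha) v hv u hu w hw)
  have hlower : ∀ h k, ∀ θ ∈ U, ∀ p q r d : ℕ, p + q + r + d ≤ L + 1 → ∀ v ∈ gA.piece p,
      ∀ u ∈ gB.piece q, ∀ w ∈ gC.piece r, ∀ a ∈ weightSpace V d,
      lowerTerms (f h k) m p q r θ v u w d a ⊆ R :=
    fun h k θ hθ p q r d hL' v hv u hu w hw a ha =>
      lowerTerms_subset (gQ := gQ) hf hL' (hUm hθ) hv hu hw ha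
        (fun n hn => hraise h k p q r d n (by omega) (by omega) hn θ hθ v hv u hu w hw a ha)
        fun p q r hpqr v hv u hu w hw => hTR (hTmem h k p q r hpqr θ hθ v hv u hu w hw)
  have hnext : ∀ h k p q r : ℕ, p + q + r ≤ L + 1 → ∀ θ ∈ U, ∀ v ∈ gA.piece p,
      ∀ u ∈ gB.piece q, ∀ w ∈ gC.piece r, f h k m p q r θ v u w ∈ powerSeriesSpan R := by
    intro h k p q r hpqr θ hθ v hv u hu w hw
    rcases Nat.lt_or_ge L (p + q + r) with h' | h'
    · exact reduce_total_weight hf hN hL (hUm hθ) (hlower h k θ hθ) (by omega) hv hu hw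
    · exact subset_powerSeriesSpan _ (hTR (hTmem h k p q r h' θ hθ v hv u hu w hw))
  have hω := conf_mem_weightSpace V
  have hderiv : ∀ h k p q r : ℕ, p + q + r ≤ L → ∀ θ ∈ U, ∀ v ∈ gA.piece p,
      ∀ u ∈ gB.piece q, ∀ w ∈ gC.piece r,
      Submodule.span ℂ (derivTerms V f h k m p q r θ v u w) ≤ powerSeriesSpan R := by
    intro h k p q r hpqr θ hθ v hv u hu w hw
    refine Submodule.span_le.2 ?_
    rintro s (rfl | rfl | rfl | rfl | rfl | rfl | rfl)
    · exact subset_powerSeriesSpan _ (hTR (hTmem h k p q r hpqr θ hθ v hv u hu w hw))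
    · exact subset_powerSeriesSpan _ (hTR (hTmem (h + 1) k p q r hpqr θ hθ v hv u hu w hw))
    · exact subset_powerSeriesSpan _ (hTR (hTmem h (k + 1) p q r hpqr θ hθ v hv u hu w hw))
    -- Here L(-1) = ω_0 is the mode of index d - n - 2 with d = 2 and n = 0, so the functional drops
    -- by one degree, or vanishes when m = 0.
    · rcases Nat.eq_zero_or_pos m with rfl | hm
      · have := gQ.comp_act_eq_zero le_rfl (hUm hθ) hω
        norm_num at this
        rw [this, (hf.linear_dual ..).map_zero]
        exact zero_mem _
      · have := hraise h k p q r 2 0 (by omega) (by omega) hm θ hθ v hv u hu w hw _ hω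
        rw [show ((m - 0 - 1 : ℕ) : ℤ) = m - 1 by omega] at this
        norm_num at this
        exact subset_powerSeriesSpan _ this
    · exact hnext h k (p + 1) q r (by omega) θ hθ _
        ((gA.act_mem 2 _ hω 0 p v hv).1 (p + 1) (by push_cast; ring)) u hu w hw
    · exact hnext h k p (q + 1) r (by omega) θ hθ v hv _
        ((gB.act_mem 2 _ hω 0 q u hu).1 (q + 1) (by push_cast; ring)) w hw
    · exact hnext h k p q (r + 1) (by omega) θ hθ v hv u hu _
        ((gC.act_mem 2 _ hω 0 r w hw).1 (r + 1) (by push_cast; ring))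
  refine ⟨R, ?_, ?_, ?_, ?_, fun h k p q r hpqr θ hθ v hv u hu w hw =>
    hTR (hTmem h k p q r (by omega) θ hθ v hv u hu w hw)⟩
  · exact (Submodule.fg_span hTfin).sup (Submodule.fg_biSup _ _ fun n hn =>
      hSfg n (Finset.mem_range.1 hn))
  · refine hRle _ (fun s hs => ?_) hStr
    obtain ⟨h, k, p, q, r, -, θ, -, v, -, u, -, w, -, rfl⟩ := hTform s hs
    exact hf.truncated h k m p q r θ v u w
  · refine hRle ((powerSeriesSpan R).comap (coeffMul Prod.fst)) (fun s hs => ?_)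
      fun n hn s hs => powerSeriesSpan_mono (hSR n hn) (hS₁ n hn s hs)
    obtain ⟨h, k, p, q, r, hpqr, θ, hθ, v, hv, u, hu, w, hw, rfl⟩ := hTform s hs
    exact hderiv h k p q r hpqr θ hθ v hv u hu w hw (hf.deriv_fst h k m p q r θ v u w)
  · refine hRle ((powerSeriesSpan R).comap (coeffMul Prod.snd)) (fun s hs => ?_)
      fun n hn s hs => powerSeriesSpan_mono (hSR n hn) (hS₂ n hn s hs)
    obtain ⟨h, k, p, q, r, hpqr, θ, hθ, v, hv, u, hu, w, hw, rfl⟩ := hTform s hs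
    exact hderiv h k p q r hpqr θ hθ v hv u hu w hw (hf.deriv_snd h k m p q r θ v u w)

theorem IsReducibleFamily.isStringConvergent {gA : NGrading V A} {gB : NGrading V B}
    {gC : NGrading V C} {gQ : NGrading V Q} (hf : IsReducibleFamily V f)
    (hA : FiniteDimensional ℂ (A ⧸ C1Subspace V A))
    (hB : FiniteDimensional ℂ (B ⧸ C1Subspace V B))
    (hC : FiniteDimensional ℂ (C ⧸ C1Subspace V C)) {h k m p q r : ℕ} {θ : Module.Dual ℂ Q}
    {v : A} {u : B} {w : C} (hθ : θ ∈ gQ.dualPiece m) (hv : v ∈ gA.piece p)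
    (hu : u ∈ gB.piece q) (hw : w ∈ gC.piece r) :
    IsStringConvergent (f h k m p q r θ v u w) := by
  obtain ⟨S, hfg, htr, h₁, h₂, hmem⟩ := hf.exists_differential_system hA hB hC m
    (Submodule.span ℂ {θ}) (Submodule.fg_span_singleton θ)
    (Submodule.span_le.2 (Set.singleton_subset_iff.2 hθ)) (p + q + r)
  have : FiniteDimensional ℂ S := (Submodule.fg_iff_finiteDimensional _).1 hfg
  exact isStringConvergent_of_differential_system S htr h₁ h₂ _
    (hmem h k p q r le_rfl θ (Submodule.mem_span_singleton_self θ) v hv u hu w hw)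

end Reducible

/-! ### Special cases of the Borcherds identity for intertwining operators. -/

lemma Ring.choose_neg_one_int (j : ℕ) : Ring.choose (-1 : ℤ) j = (-1) ^ j := by
  have h2 : ((1 : ℕ) : ℤ) + (j : ℤ) - 1 = (j : ℤ) := by push_cast; ring
  have := Ring.choose_neg ((1 : ℕ) : ℤ) j
  rw [h2, Ring.choose_natCast, Nat.choose_self, Units.smul_def] at this
  simpa [Int.negOnePow] using this

section Intertwining

variable {V : Type u} [AddCommGroup V] [Module ℂ V] [VertexOperatorAlgebra V]

lemma VOAModule.exists_act_eq_zero {W : Type u} [AddCommGroup W] [Module ℂ W] [VOAModule V W]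
    (a : V) (w : W) : ∃ J : ℕ, ∀ j : ℤ, (J : ℤ) ≤ j → VOAModule.act a j w = 0 := by
  obtain ⟨N, hN⟩ := VOAModule.truncation a w
  exact ⟨N.toNat, fun j hj => hN j (by omega)⟩

namespace LogIntertwiningOperator

variable {A B D : Type u}
  [AddCommGroup A] [Module ℂ A] [VOAModule V A] [AddCommGroup B] [Module ℂ B] [VOAModule V B]
  [AddCommGroup D] [Module ℂ D] [VOAModule V D] (Y : LogIntertwiningOperator V A B D)

lemma borcherds_sum (a : V) (v : A) (u : B) (m n : ℤ) (s : ℂ) (k : ℕ) {J N L : ℕ}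
    (hJ : ∀ j : ℕ, J ≤ j → VOAModule.act a (n + j) v = 0)
    (hN : ∀ j : ℕ, N ≤ j → Y.coeff k (s + j) v u = 0)
    (hL : ∀ j : ℕ, L ≤ j → VOAModule.act a (m + j) u = 0) :
    ∑ j ∈ Finset.range J,
        ((Ring.choose m j : ℤ) : ℂ) • Y.coeff k (s + m - j) (VOAModule.act a (n + j) v) u =
      ∑ j ∈ Finset.range N, ((-1 : ℂ) ^ j * ((Ring.choose n j : ℤ) : ℂ)) •
          VOAModule.act a (m + n - j) (Y.coeff k (s + j) v u) -
      ∑ j ∈ Finset.range L, ((-1 : ℂ) ^ n * (-1 : ℂ) ^ j * ((Ring.choose n j : ℤ) : ℂ)) •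
          Y.coeff k (s + n - j) v (VOAModule.act a (m + j) u) := by
  have := Y.borcherds a v u m n s k
  rwa [finsum_eq_sum_range (N := J) fun j hj => by simp [hJ j hj],
    finsum_eq_sum_range (N := N) fun j hj => by simp [hN j hj],
    finsum_eq_sum_range (N := L) fun j hj => by simp [hL j hj]] at this

/-- The commutator formula: for n = 0 both sums on the right of the Borcherds identity reduce to j =
0. -/
lemma act_coeff (a : V) (v : A) (u : B) (m : ℤ) (s : ℂ) (k : ℕ) {J : ℕ}
    (hJ : ∀ j : ℤ, (J : ℤ) ≤ j → VOAModule.act a j v = 0) :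
    VOAModule.act a m (Y.coeff k s v u) = Y.coeff k s v (VOAModule.act a m u) +
      ∑ i ∈ Finset.range J, ((Ring.choose m i : ℤ) : ℂ) •
        Y.coeff k (s + m - i) (VOAModule.act a i v) u := by
  have := Y.borcherds a v u m 0 s k
  rw [finsum_eq_sum_range (N := J) fun j hj => by simp [hJ j (by omega)],
    finsum_eq_single _ 0 fun j hj => by simp [Ring.choose_zero_ite, hj],
    finsum_eq_single _ 0 fun j hj => by simp [Ring.choose_zero_ite, hj]] at this
  simp at this
  rw [this]
  abel

/-- The Borcherds identity at n = -1, solved for the term j = 0 on the left. The free parameter m is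
the first mode of a that falls on u. -/
lemma coeff_neg_one (a : V) (v : A) (u : B) (m : ℤ) (s : ℂ) (k : ℕ) {J N L : ℕ}
    (hJ : ∀ j : ℤ, (J : ℤ) ≤ j → VOAModule.act a j v = 0)
    (hN : ∀ j : ℕ, N ≤ j → Y.coeff k (s + j) v u = 0)
    (hL : ∀ j : ℕ, L ≤ j → VOAModule.act a (m + j) u = 0) :
    Y.coeff k (s + m) (VOAModule.act a (-1) v) u =
      ∑ j ∈ Finset.range N, VOAModule.act a (m - 1 - j) (Y.coeff k (s + j) v u) +
      ∑ j ∈ Finset.range L, Y.coeff k (s - 1 - j) v (VOAModule.act a (m + j) u) -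
      ∑ j ∈ Finset.range J, ((Ring.choose m (j + 1) : ℤ) : ℂ) •
        Y.coeff k (s + m - 1 - j) (VOAModule.act a j v) u := by
  have := Y.borcherds_sum a v u m (-1) s k (J := J + 1)
    (fun j hj => hJ _ (by omega)) hN hL
  rw [Finset.sum_range_succ'] at this
  have h1 : ∀ j : ℕ, (-1 : ℂ) ^ j * (-1) ^ j = 1 := fun j => by
    rw [← mul_pow]; norm_num
  simp only [Ring.choose_neg_one_int, Int.cast_pow, Int.cast_neg, Int.cast_one, h1, one_smul,
    mul_assoc, zpow_neg_one, mul_one, inv_neg, inv_one, neg_smul, Finset.sum_neg_distrib,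
    sub_neg_eq_add, Ring.choose_zero_right, Nat.cast_zero, sub_zero, add_zero] at this
  rw [eq_sub_iff_add_eq, add_comm]
  have h2 : ∀ j : ℕ, s + m - ((j + 1 : ℕ) : ℂ) = s + m - 1 - j := fun j => by push_cast; ring
  have h3 : ∀ j : ℕ, (-1 : ℤ) + ((j + 1 : ℕ) : ℤ) = j := fun j => by push_cast; ring
  simpa only [h2, h3, ← sub_eq_add_neg] using this

/-- The associator formula: for m = 0 the left side of the Borcherds identity reduces to j = 0. -/
lemma coeff_act (a : V) (v : A) (u : B) (n : ℤ) (s : ℂ) (k : ℕ) {N L : ℕ}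
    (hN : ∀ j : ℕ, N ≤ j → Y.coeff k (s + j) v u = 0)
    (hL : ∀ j : ℤ, (L : ℤ) ≤ j → VOAModule.act a j u = 0) :
    Y.coeff k s (VOAModule.act a n v) u =
      ∑ j ∈ Finset.range N, ((-1 : ℂ) ^ j * ((Ring.choose n j : ℤ) : ℂ)) •
          VOAModule.act a (n - j) (Y.coeff k (s + j) v u) -
      ∑ j ∈ Finset.range L, ((-1 : ℂ) ^ n * (-1 : ℂ) ^ j * ((Ring.choose n j : ℤ) : ℂ)) •
          Y.coeff k (s + n - j) v (VOAModule.act a j u) := by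
  have := Y.borcherds a v u 0 n s k
  rw [finsum_eq_single _ 0 fun j hj => by simp [Ring.choose_zero_ite, hj],
    finsum_eq_sum_range (N := N) fun j hj => by simp [hN j hj],
    finsum_eq_sum_range (N := L) fun j hj => by
      rw [hL (0 + j) (by omega), map_zero, smul_zero]] at this
  simpa using this

lemma exists_coeff_eq_zero (v : A) (u : B) (s : ℂ) :
    ∃ N : ℕ, ∀ j : ℕ, N ≤ j → ∀ k, Y.coeff k (s + j) v u = 0 :=
  Y.truncation v u s

end LogIntertwiningOperator

end Intertwining

lemma powerSeriesMul_eq_sum {P N : ℕ} {q : ℕ → ℂ} {g : ComplexPowerSeries} {e : ℂ × ℂ}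
    (h : ∀ n : ℕ, N ≤ n → g (e.1 + n, e.2 - n) = 0) :
    powerSeriesMul P q g e = ∑ n ∈ Finset.range N,
      q n * g (e.1 + ((P + n : ℕ) : ℂ), e.2 - ((P + n : ℕ) : ℂ)) :=
  finsum_eq_sum_range fun n hn => by rw [h _ (by omega), mul_zero]

lemma exists_common_truncation {ι : Type*} (s : Finset ι) {g : ι → ComplexPowerSeries}
    (hg : ∀ i, g i ∈ truncatedSeries) (e : ℂ × ℂ) :
    ∃ N : ℕ, ∀ i ∈ s, ∀ n : ℕ, N ≤ n → g i (e.1 + n, e.2 - n) = 0 := by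
  choose N hN using fun i => hg i e
  exact ⟨s.sup N, fun i hi n hn => hN i n ((Finset.le_sup hi).trans hn)⟩

/-! ### Products of intertwining operators. -/

section Product

variable {V : Type u} [AddCommGroup V] [Module ℂ V] [VertexOperatorAlgebra V]
  {A B C P Q : Type u}
  [AddCommGroup A] [Module ℂ A] [VOAModule V A] [AddCommGroup B] [Module ℂ B] [VOAModule V B]
  [AddCommGroup C] [Module ℂ C] [VOAModule V C] [AddCommGroup P] [Module ℂ P] [VOAModule V P]
  [AddCommGroup Q] [Module ℂ Q] [VOAModule V Q]

/-- The series `⟨θ, Y¹_h(v, x) Y²_k(u, y) w⟩`, multiplied by the powers of `x` and `y` given by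
the degrees. -/
def productFamily (Y₁ : LogIntertwiningOperator V A P Q) (Y₂ : LogIntertwiningOperator V B C P)
    (h k : ℕ) (m p q r : ℤ) (θ : Module.Dual ℂ Q) (v : A) (u : B) (w : C) :
    ComplexPowerSeries :=
  fun e => θ (Y₁.coeff h (-e.1 - 1 + p - m) v (Y₂.coeff k (-e.2 - 1 + q + r) u w))

variable (Y₁ : LogIntertwiningOperator V A P Q) (Y₂ : LogIntertwiningOperator V B C P)

variable {Y₁ Y₂} in
lemma eq_productFamily {h k : ℕ} {m p q r : ℤ} {θ : Module.Dual ℂ Q} {v : A} {u : B} {w : C}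
    {e : ℂ × ℂ} {s t : ℂ} (hs : s = -e.1 - 1 + p - m) (ht : t = -e.2 - 1 + q + r) :
    θ (Y₁.coeff h s v (Y₂.coeff k t u w)) = productFamily Y₁ Y₂ h k m p q r θ v u w e := by
  rw [hs, ht, productFamily]

lemma productFamily_mem_truncatedSeries (h k : ℕ) (m p q r : ℤ) (θ : Module.Dual ℂ Q) (v : A)
    (u : B) (w : C) : productFamily Y₁ Y₂ h k m p q r θ v u w ∈ truncatedSeries := by
  intro e
  obtain ⟨N, hN⟩ := Y₂.exists_coeff_eq_zero u w (-e.2 - 1 + q + r)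
  refine ⟨N, fun n hn => ?_⟩
  have h1 : -(e.2 - (n : ℂ)) - 1 + q + r = -e.2 - 1 + q + r + n := by ring
  simp only [productFamily, h1, hN n hn, map_zero]

/-- The identity for Y¹ is used with m = wt(a) - 1, so that only modes of index at least wt(a) - 1
fall on Y²(u, y)w. Commuted past Y², they produce (y/x)^j with j ≥ 0 after normalization; starting
from the mode a_0 would produce negative powers. -/
lemma productFamily_reduce_fst (h k : ℕ) (m p q r : ℤ) (θ : Module.Dual ℂ Q) (v : A)
    (u : B) (w : C) (d : ℕ) (a : V) (hd : 1 ≤ d) (M : ℕ)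
    (hM : ∀ n : ℕ, M ≤ n → θ ∘ₗ VOAModule.act a ((d : ℤ) - n - 2) = 0) :
    productFamily Y₁ Y₂ h k m (p + d) q r θ (VOAModule.act a (-1) v) u w ∈
      powerSeriesSpan (lowerTerms (productFamily Y₁ Y₂ h k) m p q r θ v u w d a) := by
  obtain ⟨d, rfl⟩ : ∃ c, d = c + 1 := ⟨d - 1, by omega⟩
  obtain ⟨Jv, hJv⟩ := VOAModule.exists_act_eq_zero a v
  obtain ⟨Ju, hJu⟩ := VOAModule.exists_act_eq_zero a u
  obtain ⟨Jw, hJw⟩ := VOAModule.exists_act_eq_zero a w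
  set f := productFamily Y₁ Y₂ h k with hf
  set gu : ℕ → ComplexPowerSeries := fun i =>
    f m p (q + (d + 1 : ℕ) - 1 - i) r θ v (VOAModule.act a i u) w with hgu
  set gw : ℕ → ComplexPowerSeries := fun j =>
    f m p q (r + (d + 1 : ℕ) - 1 - (d + j : ℕ)) θ v u (VOAModule.act a (d + j : ℕ) w) with hgw
  set gv : ℕ → ComplexPowerSeries := fun j =>
    f m (p + (d + 1 : ℕ) - 1 - j) q r θ (VOAModule.act a j v) u w with hgv
  set gθ : ℕ → ComplexPowerSeries := fun n =>
    f (m - n - 1) p q r (θ ∘ₗ VOAModule.act a (((d + 1 : ℕ) : ℤ) - n - 2)) v u w with hgθ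
  have key : f m (p + (d + 1 : ℕ)) q r θ (VOAModule.act a (-1) v) u w =
      ∑ n ∈ Finset.range M, gθ n +
      (∑ j ∈ Finset.range Jw, (fun e : ℂ × ℂ => gw j (e.1 + (j : ℂ), e.2 - (j : ℂ))) +
        ∑ i ∈ Finset.range Ju,
          powerSeriesMul 0 (fun j => ((Ring.choose ((d : ℤ) + j) i : ℤ) : ℂ)) (gu i)) -
      ∑ j ∈ Finset.range Jv, ((Ring.choose (d : ℤ) (j + 1) : ℤ) : ℂ) • gv j := by
    ext e
    set s : ℂ := -e.1 + p - m with hs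
    set t : ℂ := -e.2 - 1 + q + r with ht
    obtain ⟨N₁, hN₁⟩ := VOAModule.exists_act_eq_zero a (Y₂.coeff k t u w)
    obtain ⟨N₂, hN₂⟩ := Y₁.exists_coeff_eq_zero v (Y₂.coeff k t u w) s
    obtain ⟨N₃, hN₃⟩ := exists_common_truncation (Finset.range Ju) (g := gu)
      (fun i => productFamily_mem_truncatedSeries Y₁ Y₂ h k _ _ _ _ _ _ _ _) e
    -- The cutoff N depends on e, whereas `key` must not: the functional terms stop at M, those
    -- acting on w stop at Jw, and the remaining sums over j are complete power series.
    obtain ⟨N, h1, h2, h3, h4, h5⟩ : ∃ N, N₁ ≤ N ∧ N₂ ≤ N ∧ N₃ ≤ N ∧ M ≤ N ∧ Jw ≤ N :=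
      ⟨N₁ + N₂ + N₃ + M + Jw, by omega, by omega, by omega, by omega, by omega⟩
    have hB := congrArg θ (Y₁.coeff_neg_one a v (Y₂.coeff k t u w) d s h (N := N) (L := N) hJv
      (fun j hj => hN₂ j (by omega) h) (fun j hj => hN₁ _ (by omega)))
    simp only [map_sub, map_add, map_sum, map_smul, smul_eq_mul] at hB
    have hT : f m (p + (d + 1 : ℕ)) q r θ (VOAModule.act a (-1) v) u w e =
        θ (Y₁.coeff h (s + (d : ℤ)) (VOAModule.act a (-1) v) (Y₂.coeff k t u w)) := by
      symm
      exact eq_productFamily (by simp only [hs]; push_cast; ring) ht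
    have hθ : ∑ j ∈ Finset.range N, θ (VOAModule.act a ((d : ℤ) - 1 - j)
        (Y₁.coeff h (s + j) v (Y₂.coeff k t u w))) = ∑ n ∈ Finset.range M, gθ n e := by
      rw [← Finset.sum_subset (Finset.range_mono h4)]
      · refine Finset.sum_congr rfl fun n _ => ?_
        rw [show (d : ℤ) - 1 - n = ((d + 1 : ℕ) : ℤ) - n - 2 by push_cast; ring]
        change (θ ∘ₗ VOAModule.act a _) (Y₁.coeff h _ v _) = _
        exact eq_productFamily (by simp only [hs]; push_cast; ring) ht
      · intro n _ hn
        have := LinearMap.congr_fun (hM n (by simpa using hn))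
          (Y₁.coeff h (s + n) v (Y₂.coeff k t u w))
        rw [show ((d + 1 : ℕ) : ℤ) - n - 2 = (d : ℤ) - 1 - n by push_cast; ring] at this
        simpa using this
    have hv : ∀ j : ℕ, θ (Y₁.coeff h (s + (d : ℤ) - 1 - j) (VOAModule.act a j v)
        (Y₂.coeff k t u w)) = gv j e := by
      intro j
      exact eq_productFamily (by simp only [hs]; push_cast; ring) ht
    have hw : ∑ j ∈ Finset.range N, θ (Y₁.coeff h (s - 1 - j) v
        (VOAModule.act a ((d : ℤ) + j) (Y₂.coeff k t u w))) =
        ∑ j ∈ Finset.range Jw, gw j (e.1 + (j : ℂ), e.2 - (j : ℂ)) +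
        ∑ i ∈ Finset.range Ju, powerSeriesMul 0
          (fun j => ((Ring.choose ((d : ℤ) + j) i : ℤ) : ℂ)) (gu i) e := by
      simp only [fun j : ℕ => Y₂.act_coeff a u w ((d : ℤ) + j) t k hJu, map_add, map_sum, map_smul,
        smul_eq_mul, Finset.sum_add_distrib]
      congr 1
      · rw [← Finset.sum_subset (Finset.range_mono h5)]
        · refine Finset.sum_congr rfl fun j _ => ?_
          rw [← Nat.cast_add]
          exact eq_productFamily (by simp only [hs]; ring) (by simp only [ht]; push_cast; ring)
        · intro j _ hj
          have : Jw ≤ j := by simpa using hj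
          rw [hJw _ (by omega)]
          simp
      · rw [Finset.sum_comm]
        refine Finset.sum_congr rfl fun i hi => ?_
        rw [powerSeriesMul_eq_sum (N := N) fun n hn => hN₃ i hi n (by omega)]
        refine Finset.sum_congr rfl fun j _ => ?_
        congr 1
        exact eq_productFamily (by simp only [hs]; push_cast; ring)
          (by simp only [ht]; push_cast; ring)
    rw [hT, hB, hθ, hw]
    simp only [hv, Pi.add_apply, Pi.sub_apply, Finset.sum_apply, Pi.smul_apply, smul_eq_mul]
  rw [key]
  refine sub_mem (add_mem (sum_mem fun n _ => ?_) (add_mem (sum_mem fun j _ => ?_)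
    (sum_mem fun i _ => ?_))) (sum_mem fun j _ => Submodule.smul_mem _ _ ?_)
  · exact subset_powerSeriesSpan _ ⟨n, Or.inl rfl⟩
  · exact shift_mem_powerSeriesSpan j ⟨d + j, Or.inr (Or.inr (Or.inr rfl))⟩
  · exact powerSeriesMul_mem_span 0 (choose_mem_polyBounded d i) ⟨i, Or.inr (Or.inr (Or.inl rfl))⟩
  · exact subset_powerSeriesSpan _ ⟨j, Or.inr (Or.inl rfl)⟩

/-- Moving a_{-1} off u puts modes a_{-1-j}, with factor y^j, in front of Y²(u, y)w. Their
commutators with Y¹(v, x) carry x^(-1-j-i), which normalizes to (y/x)^(wt(a)+j). -/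
lemma productFamily_reduce_snd (h k : ℕ) (m p q r : ℤ) (θ : Module.Dual ℂ Q) (v : A)
    (u : B) (w : C) (d : ℕ) (a : V) (hd : 1 ≤ d) (M : ℕ)
    (hM : ∀ n : ℕ, M ≤ n → θ ∘ₗ VOAModule.act a ((d : ℤ) - n - 2) = 0) :
    productFamily Y₁ Y₂ h k m p (q + d) r θ v (VOAModule.act a (-1) u) w ∈
      powerSeriesSpan (lowerTerms (productFamily Y₁ Y₂ h k) m p q r θ v u w d a) := by
  obtain ⟨d, rfl⟩ : ∃ c, d = c + 1 := ⟨d - 1, by omega⟩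
  obtain ⟨Jv, hJv⟩ := VOAModule.exists_act_eq_zero a v
  obtain ⟨Ju, hJu⟩ := VOAModule.exists_act_eq_zero a u
  obtain ⟨Jw, hJw⟩ := VOAModule.exists_act_eq_zero a w
  set f := productFamily Y₁ Y₂ h k with hf
  set gv : ℕ → ComplexPowerSeries := fun i =>
    f m (p + (d + 1 : ℕ) - 1 - i) q r θ (VOAModule.act a i v) u w with hgv
  set gw : ℕ → ComplexPowerSeries := fun j =>
    f m p q (r + (d + 1 : ℕ) - 1 - j) θ v u (VOAModule.act a j w) with hgw
  set gθ : ℕ → ComplexPowerSeries := fun n =>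
    f (m - (d + n : ℕ) - 1) p q r
      (θ ∘ₗ VOAModule.act a (((d + 1 : ℕ) : ℤ) - (d + n : ℕ) - 2)) v u w with hgθ
  have key : f m p (q + (d + 1 : ℕ)) r θ v (VOAModule.act a (-1) u) w =
      (∑ n ∈ Finset.range M, (fun e : ℂ × ℂ =>
          gθ n (e.1 + ((d + 1 + n : ℕ) : ℂ), e.2 - ((d + 1 + n : ℕ) : ℂ))) -
        ∑ i ∈ Finset.range Jv, powerSeriesMul (d + 1)
          (fun j => ((Ring.choose (-1 - (j : ℤ)) i : ℤ) : ℂ)) (gv i)) +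
      ∑ j ∈ Finset.range Jw, gw j := by
    ext e
    set s : ℂ := -e.1 - 1 + p - m with hs
    set t : ℂ := -e.2 - 1 + q + (d + 1 : ℕ) + r with ht
    obtain ⟨N₂, hN₂⟩ := Y₂.exists_coeff_eq_zero u w t
    obtain ⟨N₃, hN₃⟩ := exists_common_truncation (Finset.range Jv) (g := gv)
      (fun i => productFamily_mem_truncatedSeries Y₁ Y₂ h k _ _ _ _ _ _ _ _) e
    obtain ⟨N, h2, h3, h4⟩ : ∃ N, N₂ ≤ N ∧ N₃ ≤ N ∧ M ≤ N :=
      ⟨N₂ + N₃ + M, by omega, by omega, by omega⟩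
    have hB := Y₂.coeff_neg_one a u w 0 t k (N := N) (L := Jw) hJu
      (fun j hj => hN₂ j (by omega) k) (fun j hj => hJw _ (by omega))
    simp only [Ring.choose_zero_succ, Int.cast_zero, zero_smul, Finset.sum_const_zero, sub_zero,
      add_zero, zero_add, zero_sub] at hB
    have hT : f m p (q + (d + 1 : ℕ)) r θ v (VOAModule.act a (-1) u) w e =
        θ (Y₁.coeff h s v (Y₂.coeff k t (VOAModule.act a (-1) u) w)) := by
      symm
      exact eq_productFamily hs (by simp only [ht]; push_cast; ring)
    have hw : ∀ j : ℕ, θ (Y₁.coeff h s v (Y₂.coeff k (t - 1 - j) u (VOAModule.act a j w))) =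
        gw j e := by
      intro j
      exact eq_productFamily hs (by simp only [ht]; push_cast; ring)
    have hv : ∑ j ∈ Finset.range N, θ (Y₁.coeff h s v
        (VOAModule.act a (-1 - (j : ℤ)) (Y₂.coeff k (t + j) u w))) =
        ∑ n ∈ Finset.range M,
          gθ n (e.1 + ((d + 1 + n : ℕ) : ℂ), e.2 - ((d + 1 + n : ℕ) : ℂ)) -
        ∑ i ∈ Finset.range Jv, powerSeriesMul (d + 1)
          (fun j => ((Ring.choose (-1 - (j : ℤ)) i : ℤ) : ℂ)) (gv i) e := by
      simp only [fun j : ℕ => eq_sub_of_add_eq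
        (Y₁.act_coeff a v (Y₂.coeff k (t + j) u w) (-1 - (j : ℤ)) s h hJv).symm, map_sub, map_sum,
        map_smul, smul_eq_mul, Finset.sum_sub_distrib]
      congr 1
      · rw [← Finset.sum_subset (Finset.range_mono h4)]
        · refine Finset.sum_congr rfl fun n _ => ?_
          rw [show (-1 : ℤ) - n = ((d + 1 : ℕ) : ℤ) - (d + n : ℕ) - 2 by push_cast; ring]
          change (θ ∘ₗ VOAModule.act a _) (Y₁.coeff h _ v _) = _
          exact eq_productFamily (by simp only [hs]; push_cast; ring)
            (by simp only [ht]; push_cast; ring)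
        · intro n _ hn
          have : M ≤ n := by simpa using hn
          have := LinearMap.congr_fun (hM (d + n) (by omega))
            (Y₁.coeff h s v (Y₂.coeff k (t + n) u w))
          rw [show ((d + 1 : ℕ) : ℤ) - (d + n : ℕ) - 2 = -1 - n by push_cast; ring] at this
          simpa using this
      · rw [Finset.sum_comm]
        refine Finset.sum_congr rfl fun i hi => ?_
        rw [powerSeriesMul_eq_sum (N := N) fun n hn => hN₃ i hi n (by omega)]
        refine Finset.sum_congr rfl fun j _ => ?_
        congr 1
        exact eq_productFamily (by simp only [hs]; push_cast; ring)
          (by simp only [ht]; push_cast; ring)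
    rw [hT, hB]
    simp only [map_add, map_sum, hv, hw, Pi.add_apply, Pi.sub_apply, Finset.sum_apply]
  rw [key]
  refine add_mem (sub_mem (sum_mem fun n _ => ?_) (sum_mem fun i _ => ?_)) (sum_mem fun j _ => ?_)
  · exact shift_mem_powerSeriesSpan (d + 1 + n) ⟨d + n, Or.inl rfl⟩
  · exact powerSeriesMul_mem_span (d + 1) (choose_neg_mem_polyBounded i) ⟨i, Or.inr (Or.inl rfl)⟩
  · exact subset_powerSeriesSpan _ ⟨j, Or.inr (Or.inr (Or.inr rfl))⟩

/-- The mode a_{-1} is commuted past Y² and then past Y¹. Both commutators are finite sums, so only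
scalars and multiples of (y/x)^wt(a) occur as coefficients. -/
lemma productFamily_reduce_trd (h k : ℕ) (m p q r : ℤ) (θ : Module.Dual ℂ Q) (v : A)
    (u : B) (w : C) (d : ℕ) (a : V) (hd : 1 ≤ d) :
    productFamily Y₁ Y₂ h k m p q (r + d) θ v u (VOAModule.act a (-1) w) ∈
      powerSeriesSpan (lowerTerms (productFamily Y₁ Y₂ h k) m p q r θ v u w d a) := by
  obtain ⟨d, rfl⟩ : ∃ c, d = c + 1 := ⟨d - 1, by omega⟩
  obtain ⟨Jv, hJv⟩ := VOAModule.exists_act_eq_zero a v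
  obtain ⟨Ju, hJu⟩ := VOAModule.exists_act_eq_zero a u
  set f := productFamily Y₁ Y₂ h k with hf
  set gu : ℕ → ComplexPowerSeries := fun i =>
    f m p (q + (d + 1 : ℕ) - 1 - i) r θ v (VOAModule.act a i u) w with hgu
  set gv : ℕ → ComplexPowerSeries := fun j =>
    f m (p + (d + 1 : ℕ) - 1 - j) q r θ (VOAModule.act a j v) u w with hgv
  set gθ : ComplexPowerSeries :=
    f (m - d - 1) p q r (θ ∘ₗ VOAModule.act a (((d + 1 : ℕ) : ℤ) - d - 2)) v u w with hgθ
  have key : f m p q (r + (d + 1 : ℕ)) θ v u (VOAModule.act a (-1) w) =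
      (fun e : ℂ × ℂ => gθ (e.1 + ((d + 1 : ℕ) : ℂ), e.2 - ((d + 1 : ℕ) : ℂ))) -
      ∑ i ∈ Finset.range Jv, ((Ring.choose (-1 : ℤ) i : ℤ) : ℂ) •
        (fun e : ℂ × ℂ => gv i (e.1 + ((d + 1 : ℕ) : ℂ), e.2 - ((d + 1 : ℕ) : ℂ))) -
      ∑ i ∈ Finset.range Ju, ((Ring.choose (-1 : ℤ) i : ℤ) : ℂ) • gu i := by
    ext e
    set s : ℂ := -e.1 - 1 + p - m with hs
    set t : ℂ := -e.2 - 1 + q + (r + (d + 1 : ℕ)) with ht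
    have hT : f m p q (r + (d + 1 : ℕ)) θ v u (VOAModule.act a (-1) w) e =
        θ (Y₁.coeff h s v (Y₂.coeff k t u (VOAModule.act a (-1) w))) := by
      symm
      exact eq_productFamily hs (by simp only [ht]; push_cast; ring)
    have h1 := eq_sub_of_add_eq (Y₂.act_coeff a u w (-1) t k hJu).symm
    have h2 := eq_sub_of_add_eq (Y₁.act_coeff a v (Y₂.coeff k t u w) (-1) s h hJv).symm
    rw [hT, h1]
    simp only [map_sub, map_sum, map_smul, h2, smul_eq_mul, Pi.sub_apply, Finset.sum_apply,
      Pi.smul_apply]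
    congr 1
    · congr 1
      · rw [show (-1 : ℤ) = ((d + 1 : ℕ) : ℤ) - d - 2 by push_cast; ring]
        change (θ ∘ₗ VOAModule.act a _) (Y₁.coeff h _ v _) = _
        exact eq_productFamily (by simp only [hs]; push_cast; ring)
          (by simp only [ht]; push_cast; ring)
      · refine Finset.sum_congr rfl fun i _ => ?_
        congr 1
        exact eq_productFamily (by simp only [hs]; push_cast; ring)
          (by simp only [ht]; push_cast; ring)
    · refine Finset.sum_congr rfl fun i _ => ?_
      congr 1
      exact eq_productFamily hs (by simp only [ht]; push_cast; ring)
  rw [key]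
  refine sub_mem (sub_mem ?_ (sum_mem fun i _ => Submodule.smul_mem _ _ ?_))
    (sum_mem fun i _ => Submodule.smul_mem _ _ ?_)
  · exact shift_mem_powerSeriesSpan (d + 1) ⟨d, Or.inl rfl⟩
  · exact shift_mem_powerSeriesSpan (d + 1) ⟨i, Or.inr (Or.inl rfl)⟩
  · exact subset_powerSeriesSpan _ ⟨i, Or.inr (Or.inr (Or.inl rfl))⟩

theorem isReducibleFamily_productFamily : IsReducibleFamily V (productFamily Y₁ Y₂) where
  linear_dual _ _ _ _ _ _ _ _ _ := ⟨fun _ _ => rfl, fun _ _ => rfl⟩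
  linear_fst _ _ _ _ _ _ _ _ _ :=
    ⟨fun _ _ => by ext; simp [productFamily], fun _ _ => by ext; simp [productFamily]⟩
  linear_snd _ _ _ _ _ _ _ _ _ :=
    ⟨fun _ _ => by ext; simp [productFamily], fun _ _ => by ext; simp [productFamily]⟩
  linear_trd _ _ _ _ _ _ _ _ _ :=
    ⟨fun _ _ => by ext; simp [productFamily], fun _ _ => by ext; simp [productFamily]⟩
  truncated := productFamily_mem_truncatedSeries Y₁ Y₂
  log_bound := by
    obtain ⟨K₁, h₁⟩ := Y₁.log_bound
    obtain ⟨K₂, h₂⟩ := Y₂.log_bound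
    refine ⟨max K₁ K₂, fun h k hk m p q r θ v u w => ?_⟩
    ext e
    rcases hk with hk | hk
    · simp [productFamily, h₁ h (lt_of_le_of_lt (le_max_left _ _) hk)]
    · simp [productFamily, h₂ k (lt_of_le_of_lt (le_max_right _ _) hk)]
  reduce_fst h k m p q r θ v u w d a hd _ M hM :=
    productFamily_reduce_fst Y₁ Y₂ h k m p q r θ v u w d a hd M hM
  reduce_snd h k m p q r θ v u w d a hd _ M hM :=
    productFamily_reduce_snd Y₁ Y₂ h k m p q r θ v u w d a hd M hM
  reduce_trd h k m p q r θ v u w d a hd _ _ _ :=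
    productFamily_reduce_trd Y₁ Y₂ h k m p q r θ v u w d a hd
  deriv_fst h k m p q r θ v u w := by
    set ω := VertexOperatorAlgebra.conf (V := V)
    -- The scalar p - m comes from the normalizing power of x, and the last term from
    -- differentiating log(x)^(h+1).
    have key : (fun e => e.1 * productFamily Y₁ Y₂ h k m p q r θ v u w e) =
        productFamily Y₁ Y₂ h k m (p + 1) q r θ (VOAModule.act ω 0 v) u w +
        ((p : ℂ) - m) • productFamily Y₁ Y₂ h k m p q r θ v u w -
        ((h : ℂ) + 1) • productFamily Y₁ Y₂ (h + 1) k m p q r θ v u w := by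
      ext e
      have := congrArg θ (Y₁.derivative v (Y₂.coeff k (-e.2 - 1 + q + r) u w)
        (-e.1 - 1 + (p + 1) - m) h)
      rw [show -e.1 - 1 + ((p : ℂ) + 1) - m - 1 = -e.1 - 1 + p - m by ring] at this
      simp only [map_add, map_smul, smul_eq_mul] at this
      simp only [productFamily, Pi.add_apply, Pi.sub_apply, Pi.smul_apply, smul_eq_mul]
      push_cast
      rw [this]
      ring
    rw [key]
    refine sub_mem (add_mem ?_ (Submodule.smul_mem _ _ ?_)) (Submodule.smul_mem _ _ ?_) <;>
    refine Submodule.subset_span ?_ <;> simp [derivTerms, ω]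
  deriv_snd h k m p q r θ v u w := by
    set ω := VertexOperatorAlgebra.conf (V := V)
    have key : (fun e => e.2 * productFamily Y₁ Y₂ h k m p q r θ v u w e) =
        productFamily Y₁ Y₂ h k m p (q + 1) r θ v (VOAModule.act ω 0 u) w +
        ((q : ℂ) + r) • productFamily Y₁ Y₂ h k m p q r θ v u w -
        ((k : ℂ) + 1) • productFamily Y₁ Y₂ h (k + 1) m p q r θ v u w := by
      ext e
      have := congrArg (fun x => θ (Y₁.coeff h (-e.1 - 1 + p - m) v x))
        (Y₂.derivative u w (-e.2 - 1 + (q + 1) + r) k)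
      rw [show -e.2 - 1 + ((q : ℂ) + 1) + r - 1 = -e.2 - 1 + q + r by ring] at this
      simp only [map_add, map_smul, smul_eq_mul] at this
      simp only [productFamily, Pi.add_apply, Pi.sub_apply, Pi.smul_apply, smul_eq_mul]
      push_cast
      rw [this]
      ring
    rw [key]
    refine sub_mem (add_mem ?_ (Submodule.smul_mem _ _ ?_)) (Submodule.smul_mem _ _ ?_) <;>
    refine Submodule.subset_span ?_ <;> simp [derivTerms, ω]

end Product

lemma mem_polyBounded_of_norm_eq {q q' : ℕ → ℂ} (hq : q ∈ polyBounded)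
    (h : ∀ n, ‖q' n‖ = ‖q n‖) : q' ∈ polyBounded := by
  obtain ⟨C, k, hC, hb⟩ := hq
  exact ⟨C, k, hC, fun n => (h n).trans_le (hb n)⟩

/-! ### Iterates of intertwining operators. -/

section Iterate

variable {V : Type u} [AddCommGroup V] [Module ℂ V] [VertexOperatorAlgebra V]

/-- The Borcherds identity at m = n = 0: zero modes act as derivations. For a = ω this transfers
L(-1) from an inner intertwining operator to the functional and the last vector. -/
lemma LogIntertwiningOperator.act_zero_coeff {A B D : Type u}
    [AddCommGroup A] [Module ℂ A] [VOAModule V A] [AddCommGroup B] [Module ℂ B] [VOAModule V B]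
    [AddCommGroup D] [Module ℂ D] [VOAModule V D] (Y : LogIntertwiningOperator V A B D)
    (a : V) (v : A) (u : B) (s : ℂ) (k : ℕ) :
    VOAModule.act a 0 (Y.coeff k s v u) =
      Y.coeff k s v (VOAModule.act a 0 u) + Y.coeff k s (VOAModule.act a 0 v) u := by
  have := Y.borcherds a v u 0 0 s k
  rw [finsum_eq_single _ 0 fun j hj => by simp [Ring.choose_zero_ite, hj],
    finsum_eq_single _ 0 fun j hj => by simp [Ring.choose_zero_ite, hj],
    finsum_eq_single _ 0 fun j hj => by simp [Ring.choose_zero_ite, hj]] at this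
  simp at this
  rw [this]
  abel

variable {A B C P Q : Type u}
  [AddCommGroup A] [Module ℂ A] [VOAModule V A] [AddCommGroup B] [Module ℂ B] [VOAModule V B]
  [AddCommGroup C] [Module ℂ C] [VOAModule V C] [AddCommGroup P] [Module ℂ P] [VOAModule V P]
  [AddCommGroup Q] [Module ℂ Q] [VOAModule V Q]

/-- The series `⟨θ, Y¹_h(Y²_k(v, x - y) u, y) w⟩`, multiplied by the powers of `x - y` and `y`
given by the degrees; the first exponent is that of `y`. -/
def iterateFamily (Y₁ : LogIntertwiningOperator V P C Q) (Y₂ : LogIntertwiningOperator V A B P)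
    (h k : ℕ) (m p q r : ℤ) (θ : Module.Dual ℂ Q) (v : A) (u : B) (w : C) :
    ComplexPowerSeries :=
  fun e => θ (Y₁.coeff h (-e.1 - 1 + r - m) (Y₂.coeff k (-e.2 - 1 + p + q) v u) w)

variable {Y₁ : LogIntertwiningOperator V P C Q} {Y₂ : LogIntertwiningOperator V A B P} in
lemma eq_iterateFamily {h k : ℕ} {m p q r : ℤ} {θ : Module.Dual ℂ Q} {v : A} {u : B} {w : C}
    {e : ℂ × ℂ} {s t : ℂ} (hs : s = -e.1 - 1 + r - m) (ht : t = -e.2 - 1 + p + q) :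
    θ (Y₁.coeff h s (Y₂.coeff k t v u) w) = iterateFamily Y₁ Y₂ h k m p q r θ v u w e := by
  rw [hs, ht, iterateFamily]

variable (Y₁ : LogIntertwiningOperator V P C Q) (Y₂ : LogIntertwiningOperator V A B P)

lemma iterateFamily_mem_truncatedSeries (h k : ℕ) (m p q r : ℤ) (θ : Module.Dual ℂ Q) (v : A)
    (u : B) (w : C) : iterateFamily Y₁ Y₂ h k m p q r θ v u w ∈ truncatedSeries := by
  intro e
  obtain ⟨N, hN⟩ := Y₂.exists_coeff_eq_zero v u (-e.2 - 1 + p + q)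
  refine ⟨N, fun n hn => ?_⟩
  have h1 : -(e.2 - (n : ℂ)) - 1 + p + q = -e.2 - 1 + p + q + n := by ring
  simp only [iterateFamily, h1, hN n hn, map_zero, LinearMap.zero_apply]

/-- Moving a_{-1} off v gives modes a_{-1-j} on Y²(v, x - y)u, which the associator formula
distributes over the functional and w. The functional terms raise degrees by wt(a) + j + i, so both
indices stop at M; the terms with a_i w form power series in (x - y)/y. -/
lemma iterateFamily_reduce_fst (h k : ℕ) (m p q r : ℤ) (θ : Module.Dual ℂ Q) (v : A)
    (u : B) (w : C) (d : ℕ) (a : V) (hd : 1 ≤ d) (M : ℕ)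
    (hM : ∀ n : ℕ, M ≤ n → θ ∘ₗ VOAModule.act a ((d : ℤ) - n - 2) = 0) :
    iterateFamily Y₁ Y₂ h k m (p + d) q r θ (VOAModule.act a (-1) v) u w ∈
      powerSeriesSpan (lowerTerms (iterateFamily Y₁ Y₂ h k) m p q r θ v u w d a) := by
  obtain ⟨d, rfl⟩ : ∃ c, d = c + 1 := ⟨d - 1, by omega⟩
  obtain ⟨Jv, hJv⟩ := VOAModule.exists_act_eq_zero a v
  obtain ⟨Ju, hJu⟩ := VOAModule.exists_act_eq_zero a u
  obtain ⟨Jw, hJw⟩ := VOAModule.exists_act_eq_zero a w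
  set f := iterateFamily Y₁ Y₂ h k with hf
  set gu : ℕ → ComplexPowerSeries := fun i =>
    f m p (q + (d + 1 : ℕ) - 1 - i) r θ v (VOAModule.act a i u) w with hgu
  set gw : ℕ → ComplexPowerSeries := fun j =>
    f m p q (r + (d + 1 : ℕ) - 1 - j) θ v u (VOAModule.act a j w) with hgw
  set gθ : ℕ → ComplexPowerSeries := fun n =>
    f (m - (d + n : ℕ) - 1) p q r
      (θ ∘ₗ VOAModule.act a (((d + 1 : ℕ) : ℤ) - (d + n : ℕ) - 2)) v u w with hgθ
  set c : ℕ → ℕ → ℂ := fun j i => (-1) ^ i * ((Ring.choose (-1 - (j : ℤ)) i : ℤ) : ℂ) with hc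
  set b : ℕ → ℕ → ℂ := fun i j =>
    (-1) ^ (-1 - (j : ℤ)) * (-1) ^ i * ((Ring.choose (-1 - (j : ℤ)) i : ℤ) : ℂ) with hb
  have key : f m (p + (d + 1 : ℕ)) q r θ (VOAModule.act a (-1) v) u w =
      ∑ j ∈ Finset.range M, ∑ i ∈ Finset.range M, c j i • (fun e : ℂ × ℂ =>
          gθ (j + i) (e.1 + ((d + 1 + j : ℕ) : ℂ), e.2 - ((d + 1 + j : ℕ) : ℂ))) -
        ∑ i ∈ Finset.range Jw, powerSeriesMul (d + 1) (b i) (gw i) +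
      ∑ j ∈ Finset.range Ju, gu j := by
    ext e
    set s : ℂ := -e.1 - 1 + r - m with hs
    set t : ℂ := -e.2 - 1 + (p + (d + 1 : ℕ)) + q with ht
    obtain ⟨N₂, hN₂⟩ := Y₂.exists_coeff_eq_zero v u t
    obtain ⟨N₃, hN₃⟩ := exists_common_truncation (Finset.range Jw) (g := gw)
      (fun i => iterateFamily_mem_truncatedSeries Y₁ Y₂ h k _ _ _ _ _ _ _ _) e
    obtain ⟨N, h2, h3, h4⟩ : ∃ N, N₂ ≤ N ∧ N₃ ≤ N ∧ M ≤ N :=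
      ⟨N₂ + N₃ + M, by omega, by omega, by omega⟩
    choose N₄ hN₄ using fun j : ℕ => Y₁.exists_coeff_eq_zero (Y₂.coeff k (t + j) v u) w s
    obtain ⟨N', h5, h6⟩ : ∃ N', (∀ j ∈ Finset.range N, N₄ j ≤ N') ∧ M ≤ N' :=
      ⟨(Finset.range N).sup N₄ + M,
        fun j hj => (Finset.le_sup (f := N₄) hj).trans (Nat.le_add_right _ _), by omega⟩
    have hB := Y₂.coeff_neg_one a v u 0 t k (N := N) (L := Ju) hJv
      (fun j hj => hN₂ j (by omega) k) (fun j hj => hJu _ (by omega))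
    simp only [Ring.choose_zero_succ, Int.cast_zero, zero_smul, Finset.sum_const_zero, sub_zero,
      add_zero, zero_add, zero_sub] at hB
    have hT : f m (p + (d + 1 : ℕ)) q r θ (VOAModule.act a (-1) v) u w e =
        θ (Y₁.coeff h s (Y₂.coeff k t (VOAModule.act a (-1) v) u) w) := by
      symm
      exact eq_iterateFamily hs (by simp only [ht]; push_cast; ring)
    have hu : ∀ j : ℕ, θ (Y₁.coeff h s (Y₂.coeff k (t - 1 - j) v (VOAModule.act a j u)) w) =
        gu j e := by
      intro j
      exact eq_iterateFamily hs (by simp only [ht]; push_cast; ring)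
    have hv : ∑ j ∈ Finset.range N, θ (Y₁.coeff h s
        (VOAModule.act a (-1 - (j : ℤ)) (Y₂.coeff k (t + j) v u)) w) =
        ∑ j ∈ Finset.range M, ∑ i ∈ Finset.range M, c j i *
          gθ (j + i) (e.1 + ((d + 1 + j : ℕ) : ℂ), e.2 - ((d + 1 + j : ℕ) : ℂ)) -
        ∑ i ∈ Finset.range Jw, powerSeriesMul (d + 1) (b i) (gw i) e := by
      have hstep : ∀ j ∈ Finset.range N, θ (Y₁.coeff h s
          (VOAModule.act a (-1 - (j : ℤ)) (Y₂.coeff k (t + j) v u)) w) =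
          ∑ i ∈ Finset.range N', c j i * θ (VOAModule.act a (-1 - (j : ℤ) - i)
            (Y₁.coeff h (s + i) (Y₂.coeff k (t + j) v u) w)) -
          ∑ i ∈ Finset.range Jw, b i j * θ (Y₁.coeff h (s + (-1 - (j : ℤ) : ℤ) - i)
            (Y₂.coeff k (t + j) v u) (VOAModule.act a i w)) := by
        intro j hj
        rw [Y₁.coeff_act a (Y₂.coeff k (t + j) v u) w (-1 - (j : ℤ)) s h (N := N') (L := Jw)
          (fun i hi => hN₄ j i ((h5 j hj).trans hi) h) hJw]
        simp only [map_sub, map_sum, map_smul, smul_eq_mul, hc, hb]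
      rw [Finset.sum_congr rfl hstep, Finset.sum_sub_distrib]
      congr 1
      · have hzero : ∀ j i : ℕ, M ≤ j + i → θ (VOAModule.act a (-1 - (j : ℤ) - i)
            (Y₁.coeff h (s + i) (Y₂.coeff k (t + j) v u) w)) = 0 := by
          intro j i hji
          have := LinearMap.congr_fun (hM (d + (j + i)) (by omega))
            (Y₁.coeff h (s + i) (Y₂.coeff k (t + j) v u) w)
          rw [show ((d + 1 : ℕ) : ℤ) - (d + (j + i) : ℕ) - 2 = -1 - (j : ℤ) - i by
            push_cast; ring] at this
          simpa using this
        rw [← Finset.sum_subset (Finset.range_mono h4)]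
        · refine Finset.sum_congr rfl fun j _ => ?_
          rw [← Finset.sum_subset (Finset.range_mono h6)]
          · refine Finset.sum_congr rfl fun i _ => ?_
            congr 1
            rw [show -1 - (j : ℤ) - i = ((d + 1 : ℕ) : ℤ) - (d + (j + i) : ℕ) - 2 by
              push_cast; ring]
            change (θ ∘ₗ VOAModule.act a _) (Y₁.coeff h _ _ w) = _
            exact eq_iterateFamily (by simp only [hs]; push_cast; ring)
              (by simp only [ht]; push_cast; ring)
          · intro i _ hi
            have : M ≤ i := by simpa using hi
            rw [hzero j i (by omega), mul_zero]
        · intro j _ hj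
          have : M ≤ j := by simpa using hj
          exact Finset.sum_eq_zero fun i _ => by rw [hzero j i (by omega), mul_zero]
      · rw [Finset.sum_comm]
        refine Finset.sum_congr rfl fun i hi => ?_
        rw [powerSeriesMul_eq_sum (N := N) fun n hn => hN₃ i hi n (by omega)]
        refine Finset.sum_congr rfl fun j _ => ?_
        congr 1
        exact eq_iterateFamily (by simp only [hs]; push_cast; ring)
          (by simp only [ht]; push_cast; ring)
    rw [hT, hB]
    simp only [map_add, map_sum, LinearMap.add_apply, LinearMap.sum_apply, hv, hu, Pi.add_apply,
      Pi.sub_apply, Finset.sum_apply, Pi.smul_apply, smul_eq_mul]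
  rw [key]
  refine add_mem (sub_mem (sum_mem fun j _ => sum_mem fun i _ => Submodule.smul_mem _ _ ?_)
    (sum_mem fun i _ => ?_)) (sum_mem fun j _ => ?_)
  · exact shift_mem_powerSeriesSpan (d + 1 + j) ⟨d + (j + i), Or.inl rfl⟩
  · refine powerSeriesMul_mem_span (d + 1)
      (mem_polyBounded_of_norm_eq (choose_neg_mem_polyBounded i) fun n => ?_)
      ⟨i, Or.inr (Or.inr (Or.inr rfl))⟩
    simp [hb]
  · exact subset_powerSeriesSpan _ ⟨j, Or.inr (Or.inr (Or.inl rfl))⟩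

/-- After a_{-1} is commuted past Y²(v, x - y), the vector a_{-1}Y²(v, x - y)u is expanded in Y¹.
Everything is a finite sum, since the functional terms stop at M. -/
lemma iterateFamily_reduce_snd (h k : ℕ) (m p q r : ℤ) (θ : Module.Dual ℂ Q) (v : A)
    (u : B) (w : C) (d : ℕ) (a : V) (hd : 1 ≤ d) (M : ℕ)
    (hM : ∀ n : ℕ, M ≤ n → θ ∘ₗ VOAModule.act a ((d : ℤ) - n - 2) = 0) :
    iterateFamily Y₁ Y₂ h k m p (q + d) r θ v (VOAModule.act a (-1) u) w ∈
      powerSeriesSpan (lowerTerms (iterateFamily Y₁ Y₂ h k) m p q r θ v u w d a) := by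
  obtain ⟨d, rfl⟩ : ∃ c, d = c + 1 := ⟨d - 1, by omega⟩
  obtain ⟨Jv, hJv⟩ := VOAModule.exists_act_eq_zero a v
  obtain ⟨Jw, hJw⟩ := VOAModule.exists_act_eq_zero a w
  set f := iterateFamily Y₁ Y₂ h k with hf
  set gv : ℕ → ComplexPowerSeries := fun i =>
    f m (p + (d + 1 : ℕ) - 1 - i) q r θ (VOAModule.act a i v) u w with hgv
  set gw : ℕ → ComplexPowerSeries := fun j =>
    f m p q (r + (d + 1 : ℕ) - 1 - j) θ v u (VOAModule.act a j w) with hgw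
  set gθ : ℕ → ComplexPowerSeries := fun n =>
    f (m - (d + n : ℕ) - 1) p q r
      (θ ∘ₗ VOAModule.act a (((d + 1 : ℕ) : ℤ) - (d + n : ℕ) - 2)) v u w with hgθ
  have key : f m p (q + (d + 1 : ℕ)) r θ v (VOAModule.act a (-1) u) w =
      (∑ n ∈ Finset.range M, (fun e : ℂ × ℂ =>
          gθ n (e.1 + ((d + 1 : ℕ) : ℂ), e.2 - ((d + 1 : ℕ) : ℂ))) +
        ∑ j ∈ Finset.range Jw, (fun e : ℂ × ℂ =>
          gw j (e.1 + ((d + 1 : ℕ) : ℂ), e.2 - ((d + 1 : ℕ) : ℂ)))) -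
      ∑ i ∈ Finset.range Jv, ((Ring.choose (-1 : ℤ) i : ℤ) : ℂ) • gv i := by
    ext e
    set s : ℂ := -e.1 - 1 + r - m with hs
    set t : ℂ := -e.2 - 1 + p + (q + (d + 1 : ℕ)) with ht
    obtain ⟨Jx, hJx⟩ := VOAModule.exists_act_eq_zero a (Y₂.coeff k t v u)
    obtain ⟨N₂, hN₂⟩ := Y₁.exists_coeff_eq_zero (Y₂.coeff k t v u) w s
    obtain ⟨N, h2, h4⟩ : ∃ N, N₂ ≤ N ∧ M ≤ N := ⟨N₂ + M, by omega, by omega⟩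
    have hB := Y₁.coeff_neg_one a (Y₂.coeff k t v u) w 0 s h (N := N) (L := Jw) hJx
      (fun j hj => hN₂ j (by omega) h) (fun j hj => hJw _ (by omega))
    simp only [Ring.choose_zero_succ, Int.cast_zero, zero_smul, Finset.sum_const_zero, sub_zero,
      add_zero, zero_add, zero_sub] at hB
    have hT : f m p (q + (d + 1 : ℕ)) r θ v (VOAModule.act a (-1) u) w e =
        θ (Y₁.coeff h s (Y₂.coeff k t v (VOAModule.act a (-1) u)) w) := by
      symm
      exact eq_iterateFamily hs (by simp only [ht]; push_cast; ring)
    have h1 := eq_sub_of_add_eq (Y₂.act_coeff a v u (-1) t k hJv).symm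
    have hθ : ∑ j ∈ Finset.range N, θ (VOAModule.act a (-1 - (j : ℤ))
        (Y₁.coeff h (s + j) (Y₂.coeff k t v u) w)) =
        ∑ n ∈ Finset.range M, gθ n (e.1 + ((d + 1 : ℕ) : ℂ), e.2 - ((d + 1 : ℕ) : ℂ)) := by
      rw [← Finset.sum_subset (Finset.range_mono h4)]
      · refine Finset.sum_congr rfl fun n _ => ?_
        rw [show (-1 : ℤ) - n = ((d + 1 : ℕ) : ℤ) - (d + n : ℕ) - 2 by push_cast; ring]
        change (θ ∘ₗ VOAModule.act a _) (Y₁.coeff h _ _ w) = _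
        exact eq_iterateFamily (by simp only [hs]; push_cast; ring)
          (by simp only [ht]; push_cast; ring)
      · intro n _ hn
        have : M ≤ n := by simpa using hn
        have := LinearMap.congr_fun (hM (d + n) (by omega))
          (Y₁.coeff h (s + n) (Y₂.coeff k t v u) w)
        rw [show ((d + 1 : ℕ) : ℤ) - (d + n : ℕ) - 2 = -1 - n by push_cast; ring] at this
        simpa using this
    rw [hT, h1]
    simp only [map_sub, map_sum, map_smul, LinearMap.sub_apply, LinearMap.sum_apply,
      LinearMap.smul_apply, hB, map_add, smul_eq_mul, hθ, Pi.sub_apply, Pi.add_apply,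
      Finset.sum_apply, Pi.smul_apply]
    congr 1
    · congr 1
      refine Finset.sum_congr rfl fun j _ => ?_
      exact eq_iterateFamily (by simp only [hs]; push_cast; ring)
        (by simp only [ht]; push_cast; ring)
    · refine Finset.sum_congr rfl fun i _ => ?_
      congr 1
      exact eq_iterateFamily hs (by simp only [ht]; push_cast; ring)
  rw [key]
  refine sub_mem (add_mem (sum_mem fun n _ => ?_) (sum_mem fun j _ => ?_))
    (sum_mem fun i _ => Submodule.smul_mem _ _ ?_)
  · exact shift_mem_powerSeriesSpan (d + 1) ⟨d + n, Or.inl rfl⟩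
  · exact shift_mem_powerSeriesSpan (d + 1) ⟨j, Or.inr (Or.inr (Or.inr rfl))⟩
  · exact subset_powerSeriesSpan _ ⟨i, Or.inr (Or.inl rfl)⟩

/-- The identity for Y¹ is taken with m = -1 and n = wt(a) - 1 and solved for the term with a_{-1}w.
As for products, having the modes on the inner operator start at wt(a) - 1 avoids negative powers of
(x - y)/y. -/
lemma iterateFamily_reduce_trd (h k : ℕ) (m p q r : ℤ) (θ : Module.Dual ℂ Q) (v : A)
    (u : B) (w : C) (d : ℕ) (a : V) (hd : 1 ≤ d) (M : ℕ)
    (hM : ∀ n : ℕ, M ≤ n → θ ∘ₗ VOAModule.act a ((d : ℤ) - n - 2) = 0) :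
    iterateFamily Y₁ Y₂ h k m p q (r + d) θ v u (VOAModule.act a (-1) w) ∈
      powerSeriesSpan (lowerTerms (iterateFamily Y₁ Y₂ h k) m p q r θ v u w d a) := by
  obtain ⟨d, rfl⟩ : ∃ c, d = c + 1 := ⟨d - 1, by omega⟩
  obtain ⟨Jv, hJv⟩ := VOAModule.exists_act_eq_zero a v
  obtain ⟨Ju, hJu⟩ := VOAModule.exists_act_eq_zero a u
  obtain ⟨Jw, hJw⟩ := VOAModule.exists_act_eq_zero a w
  set f := iterateFamily Y₁ Y₂ h k with hf
  set gv : ℕ → ComplexPowerSeries := fun i =>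
    f m (p + (d + 1 : ℕ) - 1 - i) q r θ (VOAModule.act a i v) u w with hgv
  set gu : ℕ → ComplexPowerSeries := fun j =>
    f m p (q + (d + 1 : ℕ) - 1 - (d + j : ℕ)) r θ v (VOAModule.act a (d + j : ℕ) u) w with hgu
  set gw : ℕ → ComplexPowerSeries := fun j =>
    f m p q (r + (d + 1 : ℕ) - 1 - j) θ v u (VOAModule.act a j w) with hgw
  set gθ : ℕ → ComplexPowerSeries := fun n =>
    f (m - n - 1) p q r (θ ∘ₗ VOAModule.act a (((d + 1 : ℕ) : ℤ) - n - 2)) v u w with hgθ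
  set c : ℕ → ℂ := fun j => (-1) ^ j * ((Ring.choose (d : ℤ) j : ℤ) : ℂ) with hc
  set b : ℕ → ℂ := fun j =>
    (-1) ^ d * (-1) ^ (j + 1) * ((Ring.choose (d : ℤ) (j + 1) : ℤ) : ℂ) with hb
  have key : f m p q (r + (d + 1 : ℕ)) θ v u (VOAModule.act a (-1) w) =
      (-1 : ℂ) ^ d • (∑ n ∈ Finset.range M, c n • gθ n - ∑ j ∈ Finset.range Jw, b j • gw j -
        (∑ j ∈ Finset.range Ju, (-1 : ℂ) ^ j • (fun e : ℂ × ℂ =>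
            gu j (e.1 + (j : ℂ), e.2 - (j : ℂ))) +
          ∑ i ∈ Finset.range Jv, powerSeriesMul 0
            (fun j => (-1 : ℂ) ^ j * ((Ring.choose ((d : ℤ) + j) i : ℤ) : ℂ)) (gv i))) := by
    ext e
    set s : ℂ := -e.1 + r - m with hs
    set t : ℂ := -e.2 - 1 + p + q with ht
    obtain ⟨N₁, hN₁⟩ := VOAModule.exists_act_eq_zero a (Y₂.coeff k t v u)
    obtain ⟨N₂, hN₂⟩ := Y₁.exists_coeff_eq_zero (Y₂.coeff k t v u) w s
    obtain ⟨N₃, hN₃⟩ := exists_common_truncation (Finset.range Jv) (g := gv)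
      (fun i => iterateFamily_mem_truncatedSeries Y₁ Y₂ h k _ _ _ _ _ _ _ _) e
    obtain ⟨N, h1, h2, h3, h4, h5⟩ : ∃ N, N₁ ≤ N ∧ N₂ ≤ N ∧ N₃ ≤ N ∧ M ≤ N ∧ Ju ≤ N :=
      ⟨N₁ + N₂ + N₃ + M + Ju, by omega, by omega, by omega, by omega, by omega⟩
    have hB := congrArg θ (Y₁.borcherds_sum a (Y₂.coeff k t v u) w (-1) d s h (J := N) (N := N)
      (L := Jw + 1) (fun j hj => hN₁ _ (by omega)) (fun j hj => hN₂ j (by omega) h)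
      (fun j hj => hJw _ (by omega)))
    -- This splits off the j = 0 term of the last sum, which contains a_{-1}w.
    rw [Finset.sum_range_succ'] at hB
    simp only [map_sub, map_add, map_sum, map_smul, smul_eq_mul, Ring.choose_neg_one_int,
      Int.cast_pow, Int.cast_neg, Int.cast_one, Ring.choose_zero_right, Nat.cast_zero, sub_zero,
      add_zero, pow_zero, mul_one] at hB
    have hT : f m p q (r + (d + 1 : ℕ)) θ v u (VOAModule.act a (-1) w) e =
        θ (Y₁.coeff h (s + (d : ℤ)) (Y₂.coeff k t v u) (VOAModule.act a (-1) w)) := by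
      symm
      exact eq_iterateFamily (by simp only [hs]; push_cast; ring) ht
    have hθ : ∑ j ∈ Finset.range N, (-1 : ℂ) ^ j * ((Ring.choose (d : ℤ) j : ℤ) : ℂ) *
        θ (VOAModule.act a (-1 + (d : ℤ) - j)
          (Y₁.coeff h (s + j) (Y₂.coeff k t v u) w)) = ∑ n ∈ Finset.range M, c n * gθ n e := by
      rw [← Finset.sum_subset (Finset.range_mono h4)]
      · refine Finset.sum_congr rfl fun n _ => ?_
        congr 1
        rw [show -1 + (d : ℤ) - n = ((d + 1 : ℕ) : ℤ) - n - 2 by push_cast; ring]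
        change (θ ∘ₗ VOAModule.act a _) (Y₁.coeff h _ _ w) = _
        exact eq_iterateFamily (by simp only [hs]; push_cast; ring) ht
      · intro n _ hn
        have := LinearMap.congr_fun (hM n (by simpa using hn))
          (Y₁.coeff h (s + n) (Y₂.coeff k t v u) w)
        rw [show ((d + 1 : ℕ) : ℤ) - n - 2 = -1 + (d : ℤ) - n by push_cast; ring,
          LinearMap.comp_apply] at this
        rw [this]
        simp
    have hw : ∀ j : ℕ, θ (Y₁.coeff h (s + (d : ℤ) - ((j + 1 : ℕ) : ℂ)) (Y₂.coeff k t v u)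
        (VOAModule.act a (-1 + ((j + 1 : ℕ) : ℤ)) w)) = gw j e := by
      intro j
      rw [show -1 + ((j + 1 : ℕ) : ℤ) = j by push_cast; ring]
      exact eq_iterateFamily (by simp only [hs]; push_cast; ring) ht
    have hx : ∑ j ∈ Finset.range N, (-1 : ℂ) ^ j * θ (Y₁.coeff h (s + -1 - j)
        (VOAModule.act a ((d : ℤ) + j) (Y₂.coeff k t v u)) w) =
        ∑ j ∈ Finset.range Ju, (-1 : ℂ) ^ j * gu j (e.1 + (j : ℂ), e.2 - (j : ℂ)) +
        ∑ i ∈ Finset.range Jv, powerSeriesMul 0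
          (fun j => (-1 : ℂ) ^ j * ((Ring.choose ((d : ℤ) + j) i : ℤ) : ℂ)) (gv i) e := by
      simp only [fun j : ℕ => Y₂.act_coeff a v u ((d : ℤ) + j) t k hJv, map_add, map_sum, map_smul,
        LinearMap.add_apply, LinearMap.sum_apply, LinearMap.smul_apply, smul_eq_mul, mul_add,
        Finset.sum_add_distrib, Finset.mul_sum]
      congr 1
      · rw [← Finset.sum_subset (Finset.range_mono h5)]
        · refine Finset.sum_congr rfl fun j _ => ?_
          rw [← Nat.cast_add]
          congr 1
          exact eq_iterateFamily (by simp only [hs]; push_cast; ring)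
            (by simp only [ht]; push_cast; ring)
        · intro j _ hj
          have : Ju ≤ j := by simpa using hj
          rw [hJu _ (by omega)]
          simp
      · rw [Finset.sum_comm]
        refine Finset.sum_congr rfl fun i hi => ?_
        rw [powerSeriesMul_eq_sum (N := N) fun n hn => hN₃ i hi n (by omega)]
        refine Finset.sum_congr rfl fun j _ => ?_
        rw [mul_assoc]
        congr 2
        exact eq_iterateFamily (by simp only [hs]; push_cast; ring)
          (by simp only [ht]; push_cast; ring)
    rw [hx, hθ] at hB
    simp only [hw, zpow_natCast] at hB
    have hsq : (-1 : ℂ) ^ d * (-1 : ℂ) ^ d = 1 := by rw [← mul_pow]; norm_num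
    rw [hT]
    simp only [Pi.smul_apply, Pi.sub_apply, Pi.add_apply, Finset.sum_apply, smul_eq_mul, hb]
    rw [hB]
    linear_combination (-θ (Y₁.coeff h (s + (d : ℤ)) (Y₂.coeff k t v u)
      (VOAModule.act a (-1) w))) * hsq
  rw [key]
  refine Submodule.smul_mem _ _ (sub_mem (sub_mem (sum_mem fun n _ => Submodule.smul_mem _ _ ?_)
    (sum_mem fun j _ => Submodule.smul_mem _ _ ?_)) (add_mem
      (sum_mem fun j _ => Submodule.smul_mem _ _ ?_) (sum_mem fun i _ => ?_)))
  · exact subset_powerSeriesSpan _ ⟨n, Or.inl rfl⟩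
  · exact subset_powerSeriesSpan _ ⟨j, Or.inr (Or.inr (Or.inr rfl))⟩
  · exact shift_mem_powerSeriesSpan j ⟨d + j, Or.inr (Or.inr (Or.inl rfl))⟩
  · exact powerSeriesMul_mem_span 0
      (mem_polyBounded_of_norm_eq (choose_mem_polyBounded d i) fun n => by simp)
      ⟨i, Or.inr (Or.inl rfl)⟩

theorem isReducibleFamily_iterateFamily : IsReducibleFamily V (iterateFamily Y₁ Y₂) where
  linear_dual _ _ _ _ _ _ _ _ _ := ⟨fun _ _ => rfl, fun _ _ => rfl⟩
  linear_fst _ _ _ _ _ _ _ _ _ :=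
    ⟨fun _ _ => by ext; simp [iterateFamily], fun _ _ => by ext; simp [iterateFamily]⟩
  linear_snd _ _ _ _ _ _ _ _ _ :=
    ⟨fun _ _ => by ext; simp [iterateFamily], fun _ _ => by ext; simp [iterateFamily]⟩
  linear_trd _ _ _ _ _ _ _ _ _ :=
    ⟨fun _ _ => by ext; simp [iterateFamily], fun _ _ => by ext; simp [iterateFamily]⟩
  truncated := iterateFamily_mem_truncatedSeries Y₁ Y₂
  log_bound := by
    obtain ⟨K₁, h₁⟩ := Y₁.log_bound
    obtain ⟨K₂, h₂⟩ := Y₂.log_bound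
    refine ⟨max K₁ K₂, fun h k hk m p q r θ v u w => ?_⟩
    ext e
    rcases hk with hk | hk
    · simp [iterateFamily, h₁ h (lt_of_le_of_lt (le_max_left _ _) hk)]
    · simp [iterateFamily, h₂ k (lt_of_le_of_lt (le_max_right _ _) hk)]
  reduce_fst h k m p q r θ v u w d a hd _ M hM :=
    iterateFamily_reduce_fst Y₁ Y₂ h k m p q r θ v u w d a hd M hM
  reduce_snd h k m p q r θ v u w d a hd _ M hM :=
    iterateFamily_reduce_snd Y₁ Y₂ h k m p q r θ v u w d a hd M hM
  reduce_trd h k m p q r θ v u w d a hd _ M hM :=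
    iterateFamily_reduce_trd Y₁ Y₂ h k m p q r θ v u w d a hd M hM
  deriv_fst h k m p q r θ v u w := by
    set ω := VertexOperatorAlgebra.conf (V := V)
    have key : (fun e => e.1 * iterateFamily Y₁ Y₂ h k m p q r θ v u w e) =
        iterateFamily Y₁ Y₂ h k (m - 1) p q r (θ ∘ₗ VOAModule.act ω 0) v u w -
        iterateFamily Y₁ Y₂ h k m p q (r + 1) θ v u (VOAModule.act ω 0 w) +
        ((r : ℂ) - m) • iterateFamily Y₁ Y₂ h k m p q r θ v u w -
        ((h : ℂ) + 1) • iterateFamily Y₁ Y₂ (h + 1) k m p q r θ v u w := by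
      ext e
      -- The derivative in y puts L(-1) on x, which is not one of the arguments of the family; the
      -- derivation rule replaces it by L(-1) on the functional and on w.
      set x := Y₂.coeff k (-e.2 - 1 + p + q) v u
      have h1 := congrArg θ (Y₁.derivative x w (-e.1 - 1 + (r + 1) - m) h)
      have h2 := congrArg θ (Y₁.act_zero_coeff ω x w (-e.1 - 1 + (r + 1) - m) h)
      rw [show -e.1 - 1 + ((r : ℂ) + 1) - m - 1 = -e.1 - 1 + r - m by ring] at h1
      simp only [map_add, map_smul, smul_eq_mul] at h1 h2
      simp only [iterateFamily, Pi.add_apply, Pi.sub_apply, Pi.smul_apply, smul_eq_mul,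
        LinearMap.comp_apply]
      push_cast
      rw [show -e.1 - 1 + (r : ℂ) - (m - 1) = -e.1 - 1 + (r + 1) - m by ring, h2, h1]
      ring
    rw [key]
    refine sub_mem (add_mem (sub_mem ?_ ?_) (Submodule.smul_mem _ _ ?_))
      (Submodule.smul_mem _ _ ?_) <;>
    refine Submodule.subset_span ?_ <;> simp [derivTerms, ω]
  deriv_snd h k m p q r θ v u w := by
    set ω := VertexOperatorAlgebra.conf (V := V)
    have key : (fun e => e.2 * iterateFamily Y₁ Y₂ h k m p q r θ v u w e) =
        iterateFamily Y₁ Y₂ h k m (p + 1) q r θ (VOAModule.act ω 0 v) u w +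
        ((p : ℂ) + q) • iterateFamily Y₁ Y₂ h k m p q r θ v u w -
        ((k : ℂ) + 1) • iterateFamily Y₁ Y₂ h (k + 1) m p q r θ v u w := by
      ext e
      have := congrArg (fun x => θ (Y₁.coeff h (-e.1 - 1 + r - m) x w))
        (Y₂.derivative v u (-e.2 - 1 + (p + 1) + q) k)
      rw [show -e.2 - 1 + ((p : ℂ) + 1) + q - 1 = -e.2 - 1 + p + q by ring] at this
      simp only [map_add, map_smul, smul_eq_mul, LinearMap.add_apply, LinearMap.smul_apply] at this
      simp only [iterateFamily, Pi.add_apply, Pi.sub_apply, Pi.smul_apply, smul_eq_mul]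
      push_cast
      rw [this]
      ring
    rw [key]
    refine sub_mem (add_mem ?_ (Submodule.smul_mem _ _ ?_)) (Submodule.smul_mem _ _ ?_) <;>
    refine Submodule.subset_span ?_ <;> simp [derivTerms, ω]

end Iterate

/-! ### Reduction to homogeneous arguments, and the conclusion. -/

lemma NGrading.exists_dual_sum {V : Type u} [AddCommGroup V] [Module ℂ V]
    [VertexOperatorAlgebra V] {W : Type u} [AddCommGroup W] [Module ℂ W] [VOAModule V W]
    (g : NGrading V W) {θ : Module.Dual ℂ W} (hθ : θ ∈ g.restrictedDual) :
    ∃ s : Finset ℕ, θ = ∑ n ∈ s, θ ∘ₗ g.proj n := by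
  obtain ⟨N, hN⟩ := hθ
  refine ⟨Finset.range (N + 1), g.dual_ext fun i w hw => ?_⟩
  rw [LinearMap.sum_apply]
  simp only [LinearMap.comp_apply]
  by_cases hi : i ∈ Finset.range (N + 1)
  · rw [Finset.sum_eq_single i, g.proj_of_mem hw]
    · intro n _ hn
      rw [g.proj_of_mem_ne hw hn.symm, map_zero]
    · exact fun h => absurd hi h
  · rw [hN i (by simpa using hi) w hw]
    refine (Finset.sum_eq_zero fun n hn => ?_).symm
    rw [g.proj_of_mem_ne hw (by rintro rfl; exact hi hn), map_zero]

lemma NGrading.comp_proj_mem_dualPiece {V : Type u} [AddCommGroup V] [Module ℂ V]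
    [VertexOperatorAlgebra V] {W : Type u} [AddCommGroup W] [Module ℂ W] [VOAModule V W]
    (g : NGrading V W) (θ : Module.Dual ℂ W) (n : ℕ) : θ ∘ₗ g.proj n ∈ g.dualPiece n := by
  intro i hi w hw
  rw [LinearMap.comp_apply, g.proj_of_mem_ne hw hi, map_zero]

/-- Convergence of a reducible family for all arguments, from that for homogeneous ones. -/
theorem IsReducibleFamily.locallyNormallyConvergentOn {V : Type u} [AddCommGroup V] [Module ℂ V]
    [VertexOperatorAlgebra V] {A B C Q : Type u}
    [AddCommGroup A] [Module ℂ A] [VOAModule V A] [AddCommGroup B] [Module ℂ B] [VOAModule V B]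
    [AddCommGroup C] [Module ℂ C] [VOAModule V C] [AddCommGroup Q] [Module ℂ Q] [VOAModule V Q]
    {f : ℕ → ℕ → ℤ → ℤ → ℤ → ℤ → Module.Dual ℂ Q → A → B → C → ComplexPowerSeries}
    (hf : IsReducibleFamily V f) (hA : IsC1CofiniteNGradable V A)
    (hB : IsC1CofiniteNGradable V B) (hC : IsC1CofiniteNGradable V C) (gQ : NGrading V Q)
    (hshift : ∀ (h k : ℕ) (m p q r : ℤ), ∃ δ : ℂ × ℂ, ∀ θ v u w e,
      f h k 0 0 0 0 θ v u w e = f h k m p q r θ v u w (e + δ))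
    {X Y : ℂ × ℂ → ℂ} {D : Set (ℂ × ℂ)} (hD : ∀ p ∈ D, ‖Y p‖ < ‖X p‖)
    {θ : Module.Dual ℂ Q} (hθ : θ ∈ gQ.restrictedDual) (v : A) (u : B) (w : C) (h k : ℕ) :
    LocallyNormallyConvergentOn (f h k 0 0 0 0 θ v u w) X Y D := by
  obtain ⟨gA⟩ := hA.ngradable
  obtain ⟨gB⟩ := hB.ngradable
  obtain ⟨gC⟩ := hC.ngradable
  obtain ⟨sθ, hsθ⟩ := gQ.exists_dual_sum hθ
  obtain ⟨sv, hsv⟩ := gA.exists_sum_proj v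
  obtain ⟨su, hsu⟩ := gB.exists_sum_proj u
  obtain ⟨sw, hsw⟩ := gC.exists_sum_proj w
  have key : f h k 0 0 0 0 θ v u w = ∑ m ∈ sθ, ∑ p ∈ sv, ∑ q ∈ su, ∑ r ∈ sw,
      f h k 0 0 0 0 (θ ∘ₗ gQ.proj m) (gA.proj p v) (gB.proj q u) (gC.proj r w) := by
    conv_lhs => rw [hsθ, ← hsv, ← hsu, ← hsw]
    refine (map_sum (hf.linear_dual h k 0 0 0 0 _ _ _).mk' _ sθ).trans ?_
    refine Finset.sum_congr rfl fun m _ => ?_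
    refine (map_sum (hf.linear_fst h k 0 0 0 0 _ _ _).mk' _ sv).trans ?_
    refine Finset.sum_congr rfl fun p _ => ?_
    refine (map_sum (hf.linear_snd h k 0 0 0 0 _ _ _).mk' _ su).trans ?_
    refine Finset.sum_congr rfl fun q _ => ?_
    exact map_sum (hf.linear_trd h k 0 0 0 0 _ _ _).mk' _ sw
  rw [key]
  refine .sum fun m _ => .sum fun p _ => .sum fun q _ => .sum fun r _ => ?_
  obtain ⟨δ, hδ⟩ := hshift h k m p q r
  have := ((hf.isStringConvergent hA.cofinite hB.cofinite hC.cofinite (h := h) (k := k)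
    (gQ.comp_proj_mem_dualPiece θ m) (gA.proj_mem p v) (gB.proj_mem q u)
    (gC.proj_mem r w)).locallyNormallyConvergentOn hD).shift δ
  rwa [← funext (hδ _ _ _ _)] at this

theorem corollary3p3 {V : Type u} [AddCommGroup V] [Module ℂ V] [VertexOperatorAlgebra V]
    {A B C AB BC A_BC AB_C : Type u}
    [AddCommGroup A] [Module ℂ A] [VOAModule V A]
    [AddCommGroup B] [Module ℂ B] [VOAModule V B]
    [AddCommGroup C] [Module ℂ C] [VOAModule V C]
    [AddCommGroup AB] [Module ℂ AB] [VOAModule V AB]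
    [AddCommGroup BC] [Module ℂ BC] [VOAModule V BC]
    [AddCommGroup A_BC] [Module ℂ A_BC] [VOAModule V A_BC]
    [AddCommGroup AB_C] [Module ℂ AB_C] [VOAModule V AB_C]
    (hA : IsC1CofiniteNGradable V A) (hB : IsC1CofiniteNGradable V B)
    (hC : IsC1CofiniteNGradable V C)
    (YAB : LogIntertwiningOperator V A B AB) (hAB : IsFusionProduct V YAB)
    (YBC : LogIntertwiningOperator V B C BC) (hBC : IsFusionProduct V YBC)
    (YA_BC : LogIntertwiningOperator V A BC A_BC) (hA_BC : IsFusionProduct V YA_BC)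
    (YAB_C : LogIntertwiningOperator V AB C AB_C) (hAB_C : IsFusionProduct V YAB_C) :
    (∀ (g : NGrading V A_BC) (θ : Module.Dual ℂ A_BC), θ ∈ g.restrictedDual →
      ∀ (v : A) (u : B) (w : C) (h k : ℕ),
        LocallyNormallyConvergentOn (productSeries YA_BC YBC θ v u w h k)
          (fun p => p.1) (fun p => p.2)
          {p : ℂ × ℂ | 0 < ‖p.2‖ ∧ ‖p.2‖ < ‖p.1‖}) ∧
    (∀ (g : NGrading V AB_C) (θ : Module.Dual ℂ AB_C), θ ∈ g.restrictedDual →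
      ∀ (v : A) (u : B) (w : C) (h k : ℕ),
        LocallyNormallyConvergentOn (iterateSeries YAB_C YAB θ v u w h k)
          (fun p => p.1 - p.2) (fun p => p.2)
          {p : ℂ × ℂ | 0 < ‖p.1 - p.2‖ ∧ ‖p.1 - p.2‖ < ‖p.2‖}) := by
  constructor
  · intro g θ hθ v u w h k
    have := (isReducibleFamily_productFamily YA_BC YBC).locallyNormallyConvergentOn hA hB hC g
      (fun h k m p q r => ⟨(p - m, q + r), fun θ v u w e =>
        eq_productFamily (by simp only [Prod.fst_add]; push_cast; ring)
          (by simp only [Prod.snd_add]; push_cast; ring)⟩)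
      (X := fun p => p.1) (Y := fun p => p.2)
      (D := {p : ℂ × ℂ | 0 < ‖p.2‖ ∧ ‖p.2‖ < ‖p.1‖}) (fun p hp => hp.2) hθ v u w h k
    convert this using 1
    ext e
    simp [productSeries, productFamily]
  · intro g θ hθ v u w h k
    have := ((isReducibleFamily_iterateFamily YAB_C YAB).locallyNormallyConvergentOn hA hB hC g
      (fun h k m p q r => ⟨(r - m, p + q), fun θ v u w e =>
        eq_iterateFamily (by simp only [Prod.fst_add]; push_cast; ring)
          (by simp only [Prod.snd_add]; push_cast; ring)⟩)
      (X := fun p => p.2) (Y := fun p => p.1 - p.2)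
      (D := {p : ℂ × ℂ | 0 < ‖p.1 - p.2‖ ∧ ‖p.1 - p.2‖ < ‖p.2‖}) (fun p hp => hp.2)
      hθ v u w h k).swap
    convert this using 1
    ext e
    simp [iterateSeries, iterateFamily]
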